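/- Let $Y$ be a compact metric space with its Borel $\sigma$-algebra $\mathcal B(Y)$, and work in an $\aleph_1$-saturated nonstandard model (an extension map ${}^*$ satisfying the transfer principle, such that every family of fewer than $\aleph_1$ internal sets with the finite intersection property has nonempty intersection). For hyperreals write $r\approx s$ if $|r-s|<\varepsilon$ for every real $\varepsilon>0$; $\mathsf{st}(r)$ denotes the real number infinitely close to $r$, if it exists. Let $\{A_i : 1\le i\le T\}$, $T\in{}^*\mathbb N$, be a hyperfinite partition of ${}^*Y$ into sets of ${}^*\mathcal B(Y)$ (given by an internal sequence), such that each $A_i$ has infinitesimal diameter. Let $P,Q$ be two probability measures on $(Y,\mathcal B(Y))$ such that $Q$ dominates $P$: for every $\varepsilon>0$ there is $\delta>0$ such that $P(C)<\varepsilon$ for all $C\in\mathcal B(Y)$ with $Q(C)<\delta$. Then the internal function $\phi:{}^*Y\to{}^*\mathbb R$, $$\phi(x)=\sum_{i=1}^{T}\frac{{}^*P(A_i)}{{}^*Q(A_i)}\,\mathbf 1_{A_i}(x)\qquad(\text{with the convention } t/0=0),$$ is S-integrable with respect to ${}^*Q$. That is: $\phi$ is internally integrable; $\mathsf{st}(\phi)$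 exists $\overline{{}^*Q}$-almost surely and is $\overline{{}^*Q}$-integrable; and ${}^*\!\int\phi\,d\,{}^*Q\approx\int\mathsf{st}(\phi)\,d\overline{{}^*Q}$. Here $\overline{{}^*Q}$ is the Loeb measure of ${}^*Q$: the countably additive probability measure defined on the $\sigma$-algebra of all $A\subseteq{}^*Y$ such that for every real $\varepsilon>0$ there are $B,C\in{}^*\mathcal B(Y)$ with $B\subseteq A\subseteq C$ and ${}^*Q(C\setminus B)<\varepsilon$, with value $$\overline{{}^*Q}(A)=\sup\{\mathsf{st}({}^*Q(B)):B\subseteq A,\ B\in{}^*\mathcal B(Y)\}=\inf\{\mathsf{st}({}^*Q(C)):C\supseteq A,\ C\in{}^*\mathcal B(Y)\}.$$ -/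

import Mathlib

open MeasureTheory Filter Topology

universe u v

namespace NSA

/-- Finite types over the ground sorts: points of the space `Y`, real numbers, natural numbers,
truth values and Borel probability measures on `Y`; `fn a b` is the type of functions. -/
inductive Ty : Type
  | pt | real | nat | prop | pm
  | fn (a b : Ty)

/-- The type of sets of objects of type `a` (sets are functions into truth values). -/
abbrev Ty.set (a : Ty) : Ty := .fn a .prop

/-- The standard objects of each type: the full type hierarchy over `Y`, `ℝ`, `ℕ`
and the Borel probability measures on `Y` (`ULift` only adjusts the universe). -/
@[reducible] def Std (Y : Type u) [MeasurableSpace Y] : Ty → Type u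
  | .pt => Y
  | .real => ULift.{u} ℝ
  | .nat => ULift.{u} ℕ
  | .prop => ULift.{u} Prop
  | .pm => ProbabilityMeasure Y
  | .fn a b => Std Y a → Std Y b

/-- A family of domains, one for each type, with an application operation. -/
structure Frame where
  Dom : Ty → Type u
  app : ∀ {a b : Ty}, Dom (.fn a b) → Dom a → Dom b

/-- The standard model. -/
abbrev stdFrame (Y : Type u) [MeasurableSpace Y] : Frame.{u} where
  Dom := Std Y
  app := fun f x => f x

/-! ### First-order statements -/

/-- Variables of type `a` in a context (de Bruijn indices). -/
inductive Var : List Ty → Ty → Type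
  | zero {Γ : List Ty} {a : Ty} : Var (a :: Γ) a
  | succ {Γ : List Ty} {a b : Ty} : Var Γ a → Var (b :: Γ) a

/-- Terms: variables and applications. Constants for given objects enter as free variables. -/
inductive Term : List Ty → Ty → Type
  | var {Γ : List Ty} {a : Ty} : Var Γ a → Term Γ a
  | app {Γ : List Ty} {a b : Ty} : Term Γ (.fn a b) → Term Γ a → Term Γ b

/-- First-order formulas; each quantifier ranges over the objects of one type. -/
inductive Formula : List Ty → Type
  | eq {Γ : List Ty} {a : Ty} : Term Γ a → Term Γ a → Formula Γ
  | bot {Γ : List Ty} : Formula Γ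
  | imp {Γ : List Ty} : Formula Γ → Formula Γ → Formula Γ
  | all {Γ : List Ty} (a : Ty) : Formula (a :: Γ) → Formula Γ

/-- Assignments of objects to the variables of a context. -/
abbrev Env (D : Ty → Type u) (Γ : List Ty) : Type u := ∀ a : Ty, Var Γ a → D a

def Env.cons {D : Ty → Type u} {Γ : List Ty} {b : Ty} (x : D b) (e : Env D Γ) :
    Env D (b :: Γ)
  | _, .zero => x
  | _, .succ w => e _ w

def Term.eval (F : Frame.{u}) {Γ : List Ty} (e : Env F.Dom Γ) : {a : Ty} → Term Γ a → F.Dom a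
  | _, .var w => e _ w
  | _, .app f x => F.app (f.eval F e) (x.eval F e)

/-- Truth of a formula in a frame. -/
def Formula.Sat (F : Frame.{u}) : {Γ : List Ty} → Formula Γ → Env F.Dom Γ → Prop
  | _, .eq s t, e => s.eval F e = t.eval F e
  | _, .bot, _ => False
  | _, .imp φ ψ, e => φ.Sat F e → ψ.Sat F e
  | _, .all a φ, e => ∀ x : F.Dom a, φ.Sat F (Env.cons x e)

/-! ### Nonstandard models -/

/-- A nonstandard model of the type hierarchy over `Y`: domains of internal objects and an
extension map `star` satisfying the transfer principle, i.e. every first-order statement about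
standard objects is true iff it is true of their extensions in the nonstandard model. -/
structure Model (Y : Type u) [MeasurableSpace Y] extends Frame.{v} where
  star : ∀ {a : Ty}, Std Y a → Dom a
  transfer : ∀ {Γ : List Ty} (φ : Formula Γ) (e : Env (Std Y) Γ),
    φ.Sat (stdFrame Y) e ↔ φ.Sat toFrame (fun a w => star (e a w))

section

variable {Y : Type u} [MeasurableSpace Y]

/-- The set with characteristic function `C`. -/
def toSet {a : Ty} (C : Std Y a.set) : Set (Std Y a) := {x | (C x).down}

/-- The characteristic function of a set. -/
def ofSet {a : Ty} (s : Set (Std Y a)) : Std Y a.set := fun x => ⟨x ∈ s⟩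

/-- The real-valued function on `Y` given by an object of type `pt → real`. -/
def toFun (f : Std Y (.fn .pt .real)) : Y → ℝ := fun y => (f y).down

namespace Model

variable (M : Model.{u, v} Y)

/-- The internal truth value `p` is true. -/
def Holds (p : M.Dom .prop) : Prop := p = M.star (a := .prop) ⟨True⟩

/-- The internal subset of `*a` given by an internal object `A` of type `a.set`. -/
def ext {a : Ty} (A : M.Dom a.set) : Set (M.Dom a) := {x | M.Holds (M.app A x)}

/-- `κ`-saturation: a family of fewer than `κ` internal sets with the finite intersection
property has nonempty intersection. -/
def Saturated (κ : Cardinal.{v}) : Prop :=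
  ∀ (a : Ty) (𝓕 : Set (M.Dom a.set)), Cardinal.mk 𝓕 < κ →
    (∀ 𝓖 : Finset (M.Dom a.set), (𝓖 : Set (M.Dom a.set)) ⊆ 𝓕 → (⋂ A ∈ 𝓖, M.ext A).Nonempty) →
    (⋂ A ∈ 𝓕, M.ext A).Nonempty

/-! #### Hyperreals -/

/-- The extension `*r` of a real number. -/
def real (r : ℝ) : M.Dom .real := M.star (a := .real) ⟨r⟩

/-- The extension of the order `<`. -/
def lt (r s : M.Dom .real) : Prop :=
  M.Holds (M.app (M.app (M.star (a := .fn .real (.fn .real .prop))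
    (fun x y => ⟨x.down < y.down⟩)) r) s)

/-- The extension of the distance `|r - s|` of reals. -/
def absSub (r s : M.Dom .real) : M.Dom .real :=
  M.app (M.app (M.star (a := .fn .real (.fn .real .real)) (fun x y => ⟨|x.down - y.down|⟩)) r) s

/-- `r ≈ s`: the difference is infinitesimal (possibly zero). -/
def Close (r s : M.Dom .real) : Prop := ∀ ε : ℝ, 0 < ε → M.lt (M.absSub r s) (M.real ε)

/-- `r` is near-standard, i.e. its standard part exists. -/
def NearStd (r : M.Dom .real) : Prop := ∃ s : ℝ, M.Close r (M.real s)

open Classical in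
/-- The standard part of a hyperreal (with the value `0` if it does not exist). -/
noncomputable def st (r : M.Dom .real) : ℝ := if h : M.NearStd r then h.choose else 0

/-! #### Internal sets, measures and integrals -/

/-- `i ≤ j` in `*ℕ`. -/
def natLe (i j : M.Dom .nat) : Prop :=
  M.Holds (M.app (M.app (M.star (a := .fn .nat (.fn .nat .prop))
    (fun m n => ⟨m.down ≤ n.down⟩)) i) j)

/-- Membership in the extension of the Borel `σ`-algebra of `Y`. -/
def Borel (A : M.Dom (.set .pt)) : Prop :=
  M.Holds (M.app (M.star (a := .set (.set .pt)) (fun C => ⟨MeasurableSet (toSet C)⟩)) A)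

/-- The extension of the set difference. -/
def diff (A B : M.Dom (.set .pt)) : M.Dom (.set .pt) :=
  M.app (M.app (M.star (a := .fn (.set .pt) (.fn (.set .pt) (.set .pt)))
    (fun C D => ofSet (toSet C \ toSet D))) A) B

/-- The value `μ(A)` of an internal probability measure. -/
noncomputable def meas (μ : M.Dom .pm) (A : M.Dom (.set .pt)) : M.Dom .real :=
  M.app (M.app (M.star (a := .fn .pm (.fn (.set .pt) .real)) (fun ν C => ⟨ν (toSet C)⟩)) μ) A

/-- Internal integrability of `F : *Y → *ℝ` with respect to `μ`. -/
def InternallyIntegrable (μ : M.Dom .pm) (F : M.Dom (.fn .pt .real)) : Prop :=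
  M.Holds (M.app (M.app (M.star (a := .fn .pm (.set (.fn .pt .real)))
    (fun ν f => ⟨Integrable (toFun f) (ν : Measure Y)⟩)) μ) F)

/-- The internal integral `*∫ F dμ`. -/
noncomputable def integral (μ : M.Dom .pm) (F : M.Dom (.fn .pt .real)) : M.Dom .real :=
  M.app (M.app (M.star (a := .fn .pm (.fn (.fn .pt .real) .real))
    (fun ν f => ⟨∫ y, toFun f y ∂(ν : Measure Y)⟩)) μ) F

/-! #### The Loeb space and S-integrability -/

/-- `A ⊆ *Y` (not necessarily internal) is Loeb measurable for `μ`: it can be approximated from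
inside and outside by `*`Borel sets up to any standard `ε > 0`. -/
def LoebMeasurable (μ : M.Dom .pm) (A : Set (M.Dom .pt)) : Prop :=
  ∀ ε : ℝ, 0 < ε → ∃ Ai Ao : M.Dom (.set .pt), M.Borel Ai ∧ M.Borel Ao ∧
    M.ext Ai ⊆ A ∧ A ⊆ M.ext Ao ∧ M.lt (M.meas μ (M.diff Ao Ai)) (M.real ε)

/-- `(*Y, 𝓐, ν)` is the Loeb space of `(*Y, *Borel, μ)`. -/
structure IsLoebSpace (μ : M.Dom .pm) (𝓐 : MeasurableSpace (M.Dom .pt))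
    (ν : @Measure (M.Dom .pt) 𝓐) : Prop where
  measurableSet_iff : ∀ A, MeasurableSet[𝓐] A ↔ M.LoebMeasurable μ A
  inner : ∀ A, M.LoebMeasurable μ A → IsLUB
    {r | ∃ Ai, M.Borel Ai ∧ M.ext Ai ⊆ A ∧ r = ENNReal.ofReal (M.st (M.meas μ Ai))} (ν A)
  outer : ∀ A, M.LoebMeasurable μ A → IsGLB
    {r | ∃ Ao, M.Borel Ao ∧ A ⊆ M.ext Ao ∧ r = ENNReal.ofReal (M.st (M.meas μ Ao))} (ν A)

/-- The `σ`-algebra of the Loeb space is unique. -/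
theorem IsLoebSpace.space_unique {μ : M.Dom .pm} {𝓐 𝓑 : MeasurableSpace (M.Dom .pt)}
    {ν : @Measure (M.Dom .pt) 𝓐} {ν' : @Measure (M.Dom .pt) 𝓑}
    (h : M.IsLoebSpace μ 𝓐 ν) (h' : M.IsLoebSpace μ 𝓑 ν') : 𝓐 = 𝓑 :=
  MeasurableSpace.ext fun A => (h.measurableSet_iff A).trans (h'.measurableSet_iff A).symm

/-- The measure of the Loeb space is unique. -/
theorem IsLoebSpace.measure_unique {μ : M.Dom .pm} {𝓐 : MeasurableSpace (M.Dom .pt)}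
    {ν ν' : @Measure (M.Dom .pt) 𝓐}
    (h : M.IsLoebSpace μ 𝓐 ν) (h' : M.IsLoebSpace μ 𝓐 ν') : ν = ν' :=
  Measure.ext fun A hA =>
    (h.inner A ((h.measurableSet_iff A).1 hA)).unique (h'.inner A ((h.measurableSet_iff A).1 hA))

/-- The internal function `F : *Y → *ℝ` is S-integrable with respect to the internal probability
measure `μ`: it is internally integrable, its standard part `st F` exists almost surely and is
integrable with respect to the Loeb measure (which exists and is unique), and
`*∫ F dμ ≈ ∫ st F dν` for the Loeb measure `ν`. -/
def SIntegrable (μ : M.Dom .pm) (F : M.Dom (.fn .pt .real)) : Prop :=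
  M.InternallyIntegrable μ F ∧
  ∃ (𝓐 : MeasurableSpace (M.Dom .pt)) (ν : @Measure (M.Dom .pt) 𝓐), M.IsLoebSpace μ 𝓐 ν ∧
    (∀ᵐ x ∂ν, M.NearStd (M.app F x)) ∧
    Integrable (fun x => M.st (M.app F x)) ν ∧
    M.Close (M.integral μ F) (M.real (∫ x, M.st (M.app F x) ∂ν))

end Model

/-- `Q` dominates `P`. -/
def Dominates (Q P : ProbabilityMeasure Y) : Prop :=
  ∀ ε : ℝ, 0 < ε → ∃ δ : ℝ, 0 < δ ∧
    ∀ C : Set Y, MeasurableSet C → (Q C : ℝ) < δ → (P C : ℝ) < ε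

open Classical in
/-- The function `x ↦ ∑_{i=1}^n P(A_i)/Q(A_i) · 1_{A_i}(x)` for a sequence of sets `A`
(with `t/0 = 0`), as a function of `P`, `Q`, `A`, `n`, `x`. -/
noncomputable def approximant : Std Y
    (.fn .pm (.fn .pm (.fn (.fn .nat (.set .pt)) (.fn .nat (.fn .pt .real))))) :=
  fun P Q A n x => ⟨∑ i ∈ Finset.Icc 1 n.down,
    (P (toSet (A ⟨i⟩)) : ℝ) / (Q (toSet (A ⟨i⟩)) : ℝ) *
      (toSet (A ⟨i⟩)).indicator (fun _ => (1 : ℝ)) x⟩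

/-- The hyperfinite Radon-Nikodym approximant `∑_{i=1}^T *P(A_i)/*Q(A_i) · 1_{A_i}`, an internal
function `*Y → *ℝ` obtained by extending the finite construction. -/
noncomputable def Model.hyperApproximant (M : Model.{u, v} Y) (P Q : ProbabilityMeasure Y)
    (A : M.Dom (.fn .nat (.set .pt))) (T : M.Dom .nat) : M.Dom (.fn .pt .real) :=
  M.app (M.app (M.app (M.app (M.star approximant) (M.star (a := .pm) P))
    (M.star (a := .pm) Q)) A) T

end

/-- `{A_i : 1 ≤ i ≤ T}` is a hyperfinite partition of `*Y` into `*`Borel sets of infinitesimal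
diameter (`A` is an internal sequence and `T ∈ *ℕ`). -/
structure Model.IsFinePartition {Y : Type u} [MetricSpace Y] [MeasurableSpace Y]
    (M : Model.{u, v} Y) (A : M.Dom (.fn .nat (.set .pt))) (T : M.Dom .nat) : Prop where
  borel : ∀ i, M.natLe (M.star (a := .nat) ⟨1⟩) i → M.natLe i T → M.Borel (M.app A i)
  disjoint : ∀ i j, M.natLe (M.star (a := .nat) ⟨1⟩) i → M.natLe i T →
    M.natLe (M.star (a := .nat) ⟨1⟩) j → M.natLe j T → i ≠ j →
    Disjoint (M.ext (M.app A i)) (M.ext (M.app A j))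
  cover : ∀ x : M.Dom .pt, ∃ i, M.natLe (M.star (a := .nat) ⟨1⟩) i ∧ M.natLe i T ∧
    x ∈ M.ext (M.app A i)
  diam : ∀ i, M.natLe (M.star (a := .nat) ⟨1⟩) i → M.natLe i T →
    M.Close (M.app (M.star (a := .fn (.set .pt) .real)
      (fun C => ⟨Metric.diam (toSet C)⟩)) (M.app A i)) (M.real 0)

end NSA

/-!
The proof has three ingredients.

*Uniform integrability.* Let `A_1, …, A_n` be finitely many disjoint measurable sets and let
`f = ∑ P(A_i)/Q(A_i) · 1_{A_i}`. The integral of `f` over a union of cells `A_i` is at most the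
`P`-measure of the union. The cells with quotient above `K` have total `Q`-measure at most `1/K`, so
domination makes their total `P`-measure, and hence the integral of the tail of `f` above `K`,
smaller than `ε` as soon as `K ≥ κ ε`, where `κ` depends on `P` and `Q` alone
(`exists_isTameDensity_of_dominates`). The bound is the same for all partitions, so it transfers to
the hyperfinite one (`star_hyperApproximant`).

*The Loeb space.* The set function `st (*Q(C))` on internal Borel sets is finitely additive. By
saturation the infimum over internal Borel supersets is countably subadditive, so it is an outer
measure, and its Carathéodory sets are exactly the sets approximable from inside and outside
(`isCaratheodory_loebOuter_iff`).

*Comparison of integrals.* For an internal `F ≥ 0` with uniformly small tails, `∫ F d*Q` and the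
Loeb integral of `min (st F) K` are compared through one and the same finite sum
`∑ h (1 - st (*Q(F < (k+1) h)))` over `k < n`, where `n h = K`: each of them is the layer-cake
sum of a truncated function, up to an error `h` (`abs_integral_min_sub_level_sum_le`). Letting
`K → ∞`, monotone convergence gives the integrability of `st F` and the value of its integral
(`sIntegrable_of_isTameDensity`).

Hyperreal arithmetic is not developed. A hyperreal is handled through the cut of reals above it, and
each inequality between hyperreals is transferred as a family of statements with real parameters.
In a transferred formula the assignment lists, after the quantified variables, the standard objects
that serve as constants; the entry `⟨True⟩` expresses that a truth value holds.
-/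

namespace NSA

/-! ### Transfer of standard properties -/

/-- The de Bruijn variable with index `0`; `v1`, …, `v7` are the following ones. -/
abbrev v0 {Γ : List Ty} {a : Ty} : Term (a :: Γ) a := .var .zero
abbrev v1 {Γ : List Ty} {a b : Ty} : Term (b :: a :: Γ) a := .var (.succ .zero)
abbrev v2 {Γ : List Ty} {a b c : Ty} : Term (b :: c :: a :: Γ) a := .var (.succ (.succ .zero))
abbrev v3 {Γ : List Ty} {a b c d : Ty} : Term (b :: c :: d :: a :: Γ) a :=
  .var (.succ (.succ (.succ .zero)))
abbrev v4 {Γ : List Ty} {a b c d e : Ty} : Term (b :: c :: d :: e :: a :: Γ) a :=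
  .var (.succ (.succ (.succ (.succ .zero))))
abbrev v5 {Γ : List Ty} {a b c d e f : Ty} : Term (b :: c :: d :: e :: f :: a :: Γ) a :=
  .var (.succ (.succ (.succ (.succ (.succ .zero)))))
abbrev v6 {Γ : List Ty} {a b c d e f g : Ty} : Term (b :: c :: d :: e :: f :: g :: a :: Γ) a :=
  .var (.succ (.succ (.succ (.succ (.succ (.succ .zero))))))
abbrev v7 {Γ : List Ty} {a b c d e f g h : Ty} :
    Term (b :: c :: d :: e :: f :: g :: h :: a :: Γ) a :=
  .var (.succ (.succ (.succ (.succ (.succ (.succ (.succ .zero)))))))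

/-- The empty assignment. -/
def Env.nil {D : Ty → Type u} : Env D [] := fun _ w => nomatch w

theorem up_eq_true {p : Prop} : (ULift.up.{u} p = ⟨True⟩) ↔ p := by simp

section
variable {Y : Type u} [MeasurableSpace Y]

namespace Model

variable (M : Model.{u, v} Y)

theorem star_app {a b : Ty} (f : Std Y (.fn a b)) (x : Std Y a) :
    M.app (M.star f) (M.star x) = M.star (a := b) (f x) :=
  (M.transfer (.eq (.app v0 v1) v2)
    (Env.cons (b := .fn a b) f (Env.cons x (Env.cons (f x) Env.nil)))).1 rfl

theorem app_star_right {a b c : Ty} (f : Std Y (.fn a (.fn b c))) (x : M.Dom a) (y : Std Y b) :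
    M.app (M.app (M.star f) x) (M.star y) = M.app (M.star (a := .fn a c) fun x => f x y) x :=
  (M.transfer (.all a (.eq (.app (.app v1 v0) v2) (.app v3 v0)))
    (Env.cons (b := .fn a (.fn b c)) f (Env.cons y (Env.cons (b := .fn a c) (fun x => f x y)
      Env.nil)))).1 (fun _ => rfl) x

/-- The property `*p` of the internal object `x`. -/
def Star {a : Ty} (p : Std Y a → Prop) (x : M.Dom a) : Prop :=
  M.Holds (M.app (M.star (a := .set a) fun x => ⟨p x⟩) x)

theorem star_comp {a b : Ty} (p : Std Y b → Prop) (f : Std Y (.fn a b)) (x : M.Dom a) :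
    M.Star p (M.app (M.star f) x) ↔ M.Star (fun x => p (f x)) x := by
  have := (M.transfer (.all a (.eq (.app v2 (.app v1 v0)) (.app v3 v0)))
    (Env.cons (b := .fn a b) f (Env.cons (b := .set b) (fun y => ⟨p y⟩)
      (Env.cons (b := .set a) (fun x => ⟨p (f x)⟩) Env.nil)))).1 (fun _ => rfl) x
  exact iff_of_eq (congrArg M.Holds this)

variable {M}

theorem star_mp {a : Ty} {p q : Std Y a → Prop} {x : M.Dom a}
    (h : M.Star (fun x => p x → q x) x) (hp : M.Star p x) : M.Star q x :=
  (M.transfer (.all a (.imp (.eq (.app v1 v0) v4) (.imp (.eq (.app v2 v0) v4)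
      (.eq (.app v3 v0) v4))))
    (Env.cons (b := .set a) (fun x => ⟨p x → q x⟩) (Env.cons (b := .set a) (fun x => ⟨p x⟩)
      (Env.cons (b := .set a) (fun x => ⟨q x⟩) (Env.cons (b := .prop) ⟨True⟩ Env.nil))))).1
    (fun _ h₁ h₂ => up_eq_true.2 (up_eq_true.1 h₁ (up_eq_true.1 h₂))) x h hp

theorem star_of_forall {a : Ty} {p : Std Y a → Prop} (h : ∀ x, p x) (x : M.Dom a) :
    M.Star p x :=
  (M.transfer (.all a (.eq (.app v1 v0) v2)) (Env.cons (b := .set a) (fun x => ⟨p x⟩)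
    (Env.cons (b := .prop) ⟨True⟩ Env.nil))).1 (fun x => up_eq_true.2 (h x)) x

theorem star_mono {a : Ty} {p q : Std Y a → Prop} {x : M.Dom a} (h : ∀ x, p x → q x)
    (hp : M.Star p x) : M.Star q x :=
  star_mp (star_of_forall h x) hp

theorem star_and {a : Ty} {p q : Std Y a → Prop} {x : M.Dom a} :
    M.Star (fun x => p x ∧ q x) x ↔ M.Star p x ∧ M.Star q x :=
  ⟨fun h => ⟨star_mono (fun _ h => h.1) h, star_mono (fun _ h => h.2) h⟩,
    fun h => star_mp (star_mono (fun _ h₁ h₂ => ⟨h₁, h₂⟩) h.1) h.2⟩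

theorem star_not {a : Ty} {p : Std Y a → Prop} {x : M.Dom a} :
    M.Star (fun x => ¬ p x) x ↔ ¬ M.Star p x := by
  have h₁ := (M.transfer (.all a (.imp (.imp (.eq (.app v1 v0) v3) .bot) (.eq (.app v2 v0) v3)))
    (Env.cons (b := .set a) (fun x => ⟨p x⟩) (Env.cons (b := .set a) (fun x => ⟨¬ p x⟩)
      (Env.cons (b := .prop) ⟨True⟩ Env.nil)))).1
    (fun _ h => up_eq_true.2 fun hp => h (up_eq_true.2 hp)) x
  have h₂ := (M.transfer (.all a (.imp (.eq (.app v1 v0) v3) (.imp (.eq (.app v2 v0) v3) .bot)))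
    (Env.cons (b := .set a) (fun x => ⟨p x⟩) (Env.cons (b := .set a) (fun x => ⟨¬ p x⟩)
      (Env.cons (b := .prop) ⟨True⟩ Env.nil)))).1
    (fun _ h h' => up_eq_true.1 h' (up_eq_true.1 h)) x
  exact ⟨fun h h' => h₂ h' h, h₁⟩

theorem star_forall_lt {a : Ty} {p : ℕ → Std Y a → Prop} {x : M.Dom a} (n : ℕ)
    (h : ∀ k < n, M.Star (p k) x) : M.Star (fun x => ∀ k < n, p k x) x := by
  induction n with
  | zero => exact star_of_forall (fun _ k hk => absurd hk k.not_lt_zero) x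
  | succ n ih =>
    refine star_mono (fun y hy k hk => ?_)
      (star_and.2 ⟨ih fun k hk => h k (hk.trans n.lt_succ_self), h n n.lt_succ_self⟩)
    rcases Nat.lt_succ_iff_lt_or_eq.1 hk with hk | rfl
    exacts [hy.1 k hk, hy.2]

/-! ### Hyperreals and standard parts -/

theorem lt_real_iff {r : M.Dom .real} {q : ℝ} :
    M.lt r (M.real q) ↔ M.Star (fun r : Std Y .real => r.down < q) r := by
  unfold lt real Star
  rw [M.app_star_right]

theorem lt_absSub_iff {r : M.Dom .real} {s ε : ℝ} :
    M.lt (M.absSub r (M.real s)) (M.real ε) ↔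
      M.Star (fun r : Std Y .real => |r.down - s| < ε) r := by
  rw [lt_real_iff, absSub, real, M.app_star_right, star_comp]

theorem close_real_iff {r : M.Dom .real} {s : ℝ} :
    M.Close r (M.real s) ↔ ∀ ε > 0, M.Star (fun r : Std Y .real => |r.down - s| < ε) r :=
  forall₂_congr fun _ _ => lt_absSub_iff

theorem close_real_iff_lt {r : M.Dom .real} {s : ℝ} : M.Close r (M.real s) ↔
    (∀ q, s < q → M.lt r (M.real q)) ∧ ∀ q, M.lt r (M.real q) → s ≤ q := by
  simp only [close_real_iff, lt_real_iff]
  refine ⟨fun h => ⟨fun q hq => ?_, fun q hq => ?_⟩, fun ⟨h₁, h₂⟩ ε hε => ?_⟩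
  · refine star_mono (fun r hr => ?_) (h (q - s) (sub_pos.2 hq))
    linarith [(abs_lt.1 hr).2]
  · by_contra! hs
    refine star_not.1 (star_mono (fun r hr => ?_) (h (s - q) (sub_pos.2 hs))) hq
    linarith [(abs_lt.1 hr).1]
  · have h₃ : ¬ M.Star (fun r : Std Y .real => r.down < s - ε / 2) r := fun h => by
      linarith [h₂ _ h]
    refine star_mono (fun r hr => ?_) (star_and.2 ⟨h₁ (s + ε) (by linarith), star_not.2 h₃⟩)
    rw [abs_lt]
    constructor <;> linarith [hr.1, not_lt.1 hr.2]

theorem lt_real_mono {r : M.Dom .real} {p q : ℝ} (h : M.lt r (M.real p)) (hpq : p ≤ q) :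
    M.lt r (M.real q) := by
  rw [lt_real_iff] at *
  exact star_mono (fun _ hr => hr.trans_le hpq) h

/-- A bounded hyperreal `r` is infinitely close to the infimum of the reals above it. -/
theorem nearStd_of_bounded {r : M.Dom .real} {p q : ℝ} (hp : ¬ M.lt r (M.real p))
    (hq : M.lt r (M.real q)) : M.NearStd r := by
  have hb : BddBelow {t | M.lt r (M.real t)} :=
    ⟨p, fun t ht => not_lt.1 fun h => hp (lt_real_mono ht h.le)⟩
  refine ⟨sInf {t | M.lt r (M.real t)}, close_real_iff_lt.2 ⟨fun t ht => ?_, fun t ht => ?_⟩⟩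
  · obtain ⟨s, hs, hst⟩ := exists_lt_of_csInf_lt ⟨q, hq⟩ ht
    exact lt_real_mono hs hst.le
  · exact csInf_le hb ht

theorem NearStd.close_st {r : M.Dom .real} (h : M.NearStd r) : M.Close r (M.real (M.st r)) := by
  rw [st, dif_pos h]
  exact h.choose_spec

theorem NearStd.lt_of_st_lt {r : M.Dom .real} (h : M.NearStd r) {q : ℝ} (hq : M.st r < q) :
    M.lt r (M.real q) :=
  (close_real_iff_lt.1 h.close_st).1 q hq

theorem NearStd.st_le {r : M.Dom .real} (h : M.NearStd r) {q : ℝ} (hq : M.lt r (M.real q)) :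
    M.st r ≤ q :=
  (close_real_iff_lt.1 h.close_st).2 q hq

theorem NearStd.le_st {r : M.Dom .real} (h : M.NearStd r) {q : ℝ} (hq : ¬ M.lt r (M.real q)) :
    q ≤ M.st r :=
  not_lt.1 fun h' => hq (h.lt_of_st_lt h')

variable (M : Model.{u, v} Y)

/-! ### Internal Borel sets and their measure -/

/-- The extension of the union of two sets. -/
def union (A B : M.Dom (.set .pt)) : M.Dom (.set .pt) :=
  M.app (M.app (M.star (a := .fn (.set .pt) (.fn (.set .pt) (.set .pt)))
    (fun C D => ofSet (toSet C ∪ toSet D))) A) B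

/-- The whole space `*Y` as an internal set. -/
def univ : M.Dom (.set .pt) := M.star (a := .set .pt) (ofSet Set.univ)

variable {M}

theorem ext_diff (A B : M.Dom (.set .pt)) : M.ext (M.diff A B) = M.ext A \ M.ext B := by
  let e : Env (Std Y) [.fn (.set .pt) (.fn (.set .pt) (.set .pt)), .prop] :=
    Env.cons (b := .fn (.set .pt) (.fn (.set .pt) (.set .pt)))
      (fun C D => ofSet (toSet C \ toSet D)) (Env.cons (b := .prop) ⟨True⟩ Env.nil)
  have h₁ := (M.transfer (.all (.set .pt) (.all (.set .pt) (.all .pt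
    (.imp (.eq (.app (.app (.app v3 v2) v1) v0) v4) (.eq (.app v2 v0) v4))))) e).1
    (fun C D x h => up_eq_true.2 (up_eq_true.1 h).1) A B
  have h₂ := (M.transfer (.all (.set .pt) (.all (.set .pt) (.all .pt
    (.imp (.eq (.app (.app (.app v3 v2) v1) v0) v4) (.imp (.eq (.app v1 v0) v4) .bot))))) e).1
    (fun C D x h h' => (up_eq_true.1 h).2 (up_eq_true.1 h')) A B
  have h₃ := (M.transfer (.all (.set .pt) (.all (.set .pt) (.all .pt
    (.imp (.eq (.app v2 v0) v4) (.imp (.imp (.eq (.app v1 v0) v4) .bot)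
      (.eq (.app (.app (.app v3 v2) v1) v0) v4)))))) e).1
    (fun C D x h h' => up_eq_true.2 ⟨up_eq_true.1 h, fun h'' => h' (up_eq_true.2 h'')⟩) A B
  exact Set.ext fun x => ⟨fun h => ⟨h₁ x h, h₂ x h⟩, fun h => h₃ x h.1 h.2⟩

theorem ext_union (A B : M.Dom (.set .pt)) : M.ext (M.union A B) = M.ext A ∪ M.ext B := by
  let e : Env (Std Y) [.fn (.set .pt) (.fn (.set .pt) (.set .pt)), .prop] :=
    Env.cons (b := .fn (.set .pt) (.fn (.set .pt) (.set .pt)))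
      (fun C D => ofSet (toSet C ∪ toSet D)) (Env.cons (b := .prop) ⟨True⟩ Env.nil)
  have h₁ := (M.transfer (.all (.set .pt) (.all (.set .pt) (.all .pt
    (.imp (.eq (.app (.app (.app v3 v2) v1) v0) v4) (.imp (.imp (.eq (.app v2 v0) v4) .bot)
      (.eq (.app v1 v0) v4)))))) e).1
    (fun C D x h h' => up_eq_true.2
      ((up_eq_true.1 h).resolve_left fun h'' => h' (up_eq_true.2 h''))) A B
  have h₂ := (M.transfer (.all (.set .pt) (.all (.set .pt) (.all .pt
    (.imp (.eq (.app v2 v0) v4) (.eq (.app (.app (.app v3 v2) v1) v0) v4))))) e).1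
    (fun C D x h => up_eq_true.2 (Or.inl (up_eq_true.1 h))) A B
  have h₃ := (M.transfer (.all (.set .pt) (.all (.set .pt) (.all .pt
    (.imp (.eq (.app v1 v0) v4) (.eq (.app (.app (.app v3 v2) v1) v0) v4))))) e).1
    (fun C D x h => up_eq_true.2 (Or.inr (up_eq_true.1 h))) A B
  exact Set.ext fun x => ⟨fun h => or_iff_not_imp_left.2 (h₁ x h), fun h => h.elim (h₂ x) (h₃ x)⟩

theorem ext_univ : M.ext M.univ = Set.univ :=
  Set.eq_univ_of_forall fun x => star_of_forall (p := fun _ => True) (fun _ => trivial) x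

theorem Borel.diff {A B : M.Dom (.set .pt)} (hA : M.Borel A) (hB : M.Borel B) :
    M.Borel (M.diff A B) :=
  (M.transfer (.all (.set .pt) (.all (.set .pt) (.imp (.eq (.app v3 v1) v4)
      (.imp (.eq (.app v3 v0) v4) (.eq (.app v3 (.app (.app v2 v1) v0)) v4)))))
    (Env.cons (b := .fn (.set .pt) (.fn (.set .pt) (.set .pt)))
      (fun C D => ofSet (toSet C \ toSet D))
      (Env.cons (b := .set (.set .pt)) (fun C => ⟨MeasurableSet (toSet C)⟩)
        (Env.cons (b := .prop) ⟨True⟩ Env.nil)))).1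
    (fun _ _ h₁ h₂ => up_eq_true.2 ((up_eq_true.1 h₁).diff (up_eq_true.1 h₂))) A B hA hB

theorem Borel.union {A B : M.Dom (.set .pt)} (hA : M.Borel A) (hB : M.Borel B) :
    M.Borel (M.union A B) :=
  (M.transfer (.all (.set .pt) (.all (.set .pt) (.imp (.eq (.app v3 v1) v4)
      (.imp (.eq (.app v3 v0) v4) (.eq (.app v3 (.app (.app v2 v1) v0)) v4)))))
    (Env.cons (b := .fn (.set .pt) (.fn (.set .pt) (.set .pt)))
      (fun C D => ofSet (toSet C ∪ toSet D))
      (Env.cons (b := .set (.set .pt)) (fun C => ⟨MeasurableSet (toSet C)⟩)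
        (Env.cons (b := .prop) ⟨True⟩ Env.nil)))).1
    (fun _ _ h₁ h₂ => up_eq_true.2 ((up_eq_true.1 h₁).union (up_eq_true.1 h₂))) A B hA hB

theorem Borel.univ : M.Borel M.univ := by
  unfold Borel Model.univ
  rw [M.star_app]
  exact congrArg (M.star (a := .prop)) (up_eq_true.2 MeasurableSet.univ)

variable {Q : ProbabilityMeasure Y}

theorem meas_lt_real_iff {C : M.Dom (.set .pt)} {q : ℝ} :
    M.lt (M.meas (M.star (a := .pm) Q) C) (M.real q) ↔
      M.Star (fun C : Std Y (.set .pt) => (Q (toSet C) : ℝ) < q) C := by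
  rw [lt_real_iff, meas, M.star_app, star_comp]

variable (Q) in
/-- The real part `st(*Q(C))` of the measure of an internal set. -/
noncomputable def stMeas (C : M.Dom (.set .pt)) : ℝ := M.st (M.meas (M.star (a := .pm) Q) C)

theorem not_meas_lt_zero (C : M.Dom (.set .pt)) :
    ¬ M.lt (M.meas (M.star (a := .pm) Q) C) (M.real 0) := by
  rw [meas_lt_real_iff, ← star_not]
  exact star_of_forall (fun C => not_lt.2 NNReal.zero_le_coe) C

theorem nearStd_meas (C : M.Dom (.set .pt)) : M.NearStd (M.meas (M.star (a := .pm) Q) C) := by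
  refine nearStd_of_bounded (not_meas_lt_zero C) (q := 2) ?_
  rw [meas_lt_real_iff]
  refine star_of_forall (fun C => ?_) C
  have : (Q (toSet C) : ℝ) ≤ 1 := by exact_mod_cast Q.apply_le_one _
  linarith

theorem stMeas_nonneg (C : M.Dom (.set .pt)) : 0 ≤ stMeas Q C :=
  (nearStd_meas C).le_st (not_meas_lt_zero C)

theorem stMeas_le_of_meas_lt {C : M.Dom (.set .pt)} {q : ℝ}
    (h : M.lt (M.meas (M.star (a := .pm) Q) C) (M.real q)) : stMeas Q C ≤ q :=
  (nearStd_meas C).st_le h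

theorem meas_lt_of_stMeas_lt {C : M.Dom (.set .pt)} {q : ℝ} (h : stMeas Q C < q) :
    M.lt (M.meas (M.star (a := .pm) Q) C) (M.real q) :=
  (nearStd_meas C).lt_of_st_lt h

theorem stMeas_univ : stMeas Q M.univ = 1 := by
  have h : ∀ q : ℝ, M.lt (M.meas (M.star (a := .pm) Q) M.univ) (M.real q) ↔ (1 : ℝ) < q := by
    intro q
    rw [meas_lt_real_iff]
    have h : (Q (toSet (ofSet Set.univ : Std Y (.set .pt))) : ℝ) = 1 := by
      have : toSet (ofSet Set.univ : Std Y (.set .pt)) = Set.univ := rfl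
      rw [this]; simp
    have h₂ := (M.transfer (.eq v0 v1) (Env.cons (b := .prop)
      ⟨(Q (toSet (ofSet Set.univ : Std Y (.set .pt))) : ℝ) < q⟩
      (Env.cons (b := .prop) ⟨True⟩ Env.nil)))
    unfold Star Model.univ
    rw [M.star_app]
    exact h₂.symm.trans (up_eq_true.trans (by rw [h]))
  refine le_antisymm (le_of_forall_gt fun q hq => ?_) ((nearStd_meas _).le_st fun h' => ?_)
  · obtain ⟨p, hp, hpq⟩ := exists_between hq
    exact (stMeas_le_of_meas_lt ((h p).2 hp)).trans_lt hpq
  · exact lt_irrefl _ ((h 1).1 h')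

theorem stMeas_mono {C D : M.Dom (.set .pt)} (h : M.ext C ⊆ M.ext D) :
    stMeas Q C ≤ stMeas Q D := by
  refine le_of_forall_gt fun q hq => ?_
  obtain ⟨p, hp, hpq⟩ := exists_between hq
  refine (stMeas_le_of_meas_lt ?_).trans_lt hpq
  have hD := meas_lt_of_stMeas_lt hp
  rw [meas_lt_real_iff] at hD ⊢
  exact (M.transfer (.all (.set .pt) (.all (.set .pt)
      (.imp (.all .pt (.imp (.eq (.app v2 v0) v4) (.eq (.app v1 v0) v4)))
        (.imp (.eq (.app v2 v0) v3) (.eq (.app v2 v1) v3)))))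
    (Env.cons (b := .set (.set .pt)) (fun C => ⟨(Q (toSet C) : ℝ) < p⟩)
      (Env.cons (b := .prop) ⟨True⟩ Env.nil))).1
    (fun C D h h' => up_eq_true.2 (lt_of_le_of_lt
      (NNReal.coe_le_coe.2 (Q.apply_mono fun x hx => up_eq_true.1 (h x (up_eq_true.2 hx))))
      (up_eq_true.1 h'))) C D (fun _ hx => h hx) hD

theorem stMeas_union_le (C D : M.Dom (.set .pt)) :
    stMeas Q (M.union C D) ≤ stMeas Q C + stMeas Q D := by
  refine le_of_forall_pos_le_add fun ε hε => ?_
  have hC := meas_lt_of_stMeas_lt (Q := Q) (C := C) (lt_add_of_pos_right _ (half_pos hε))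
  have hD := meas_lt_of_stMeas_lt (Q := Q) (C := D) (lt_add_of_pos_right _ (half_pos hε))
  have : stMeas Q C + stMeas Q D + ε = (stMeas Q C + ε / 2) + (stMeas Q D + ε / 2) := by ring
  rw [this]
  generalize stMeas Q C + ε / 2 = p at *
  generalize stMeas Q D + ε / 2 = q at *
  refine stMeas_le_of_meas_lt ?_
  rw [meas_lt_real_iff] at hC hD ⊢
  rw [union]
  exact (M.transfer (.all (.set .pt) (.all (.set .pt)
      (.imp (.eq (.app v2 v1) v6) (.imp (.eq (.app v3 v0) v6)
        (.eq (.app v4 (.app (.app v5 v1) v0)) v6)))))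
    (Env.cons (b := .set (.set .pt)) (fun C => ⟨(Q (toSet C) : ℝ) < p⟩)
      (Env.cons (b := .set (.set .pt)) (fun C => ⟨(Q (toSet C) : ℝ) < q⟩)
      (Env.cons (b := .set (.set .pt)) (fun C => ⟨(Q (toSet C) : ℝ) < p + q⟩)
      (Env.cons (b := .fn (.set .pt) (.fn (.set .pt) (.set .pt)))
        (fun C D => ofSet (toSet C ∪ toSet D))
      (Env.cons (b := .prop) ⟨True⟩ Env.nil)))))).1
    (fun C D h h' => up_eq_true.2 (lt_of_le_of_lt
      (NNReal.coe_le_coe.2 (Q.apply_union_le (s₁ := toSet C) (s₂ := toSet D)))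
      (add_lt_add (up_eq_true.1 h) (up_eq_true.1 h')))) C D hC hD

theorem stMeas_diff_add_le (C : M.Dom (.set .pt)) {D : M.Dom (.set .pt)} (hD : M.Borel D) :
    stMeas Q (M.diff C (M.diff C D)) + stMeas Q (M.diff C D) ≤ stMeas Q C := by
  refine le_of_forall_pos_le_add fun ε hε => ?_
  have h₁ : ¬ M.lt (M.meas (M.star (a := .pm) Q) (M.diff C (M.diff C D)))
      (M.real (stMeas Q (M.diff C (M.diff C D)) - ε / 2)) := fun h => by
    linarith [stMeas_le_of_meas_lt h]
  have h₂ : ¬ M.lt (M.meas (M.star (a := .pm) Q) (M.diff C D))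
      (M.real (stMeas Q (M.diff C D) - ε / 2)) := fun h => by
    linarith [stMeas_le_of_meas_lt h]
  suffices h : ¬ M.lt (M.meas (M.star (a := .pm) Q) C)
      (M.real ((stMeas Q (M.diff C (M.diff C D)) - ε / 2) + (stMeas Q (M.diff C D) - ε / 2))) by
    linarith [(nearStd_meas C).le_st h, show stMeas Q C = M.st _ from rfl]
  generalize stMeas Q (M.diff C (M.diff C D)) - ε / 2 = p at *
  generalize stMeas Q (M.diff C D) - ε / 2 = q at *
  rw [meas_lt_real_iff] at h₁ h₂ ⊢
  exact (M.transfer (.all (.set .pt) (.all (.set .pt)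
      (.imp (.eq (.app v2 v0) v7)
        (.imp (.imp (.eq (.app v3 (.app (.app v6 v1) (.app (.app v6 v1) v0))) v7) .bot)
          (.imp (.imp (.eq (.app v4 (.app (.app v6 v1) v0)) v7) .bot)
            (.imp (.eq (.app v5 v1) v7) .bot))))))
    (Env.cons (b := .set (.set .pt)) (fun C => ⟨MeasurableSet (toSet C)⟩)
      (Env.cons (b := .set (.set .pt)) (fun C => ⟨(Q (toSet C) : ℝ) < p⟩)
      (Env.cons (b := .set (.set .pt)) (fun C => ⟨(Q (toSet C) : ℝ) < q⟩)
      (Env.cons (b := .set (.set .pt)) (fun C => ⟨(Q (toSet C) : ℝ) < p + q⟩)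
      (Env.cons (b := .fn (.set .pt) (.fn (.set .pt) (.set .pt)))
        (fun C D => ofSet (toSet C \ toSet D))
      (Env.cons (b := .prop) ⟨True⟩ Env.nil))))))).1
    (fun C D hD h₁ h₂ h₃ => by
      have h₁' : p ≤ ((Q : Measure Y).real (toSet C \ (toSet C \ toSet D))) :=
        not_lt.1 fun h => h₁ (up_eq_true.2 h)
      have h₂' : q ≤ ((Q : Measure Y).real (toSet C \ toSet D)) :=
        not_lt.1 fun h => h₂ (up_eq_true.2 h)
      have h₃' : ((Q : Measure Y).real (toSet C)) < p + q := up_eq_true.1 h₃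
      rw [Set.sdiff_sdiff_right_self] at h₁'
      have := measureReal_inter_add_sdiff (μ := (Q : Measure Y)) (s := toSet C)
        (up_eq_true.1 hD : MeasurableSet (toSet D))
      exact absurd h₃' (by linarith)) C D hD h₁ h₂

/-! ### The Loeb space -/

/-- Countably many internal sets that have, finitely many at a time, a common internal Borel
superset of measure less than `r` have one all together. -/
theorem exists_superset_of_saturated (hM : M.Saturated (Cardinal.aleph 1))
    (C : ℕ → M.Dom (.set .pt)) (r : ℝ)
    (h : ∀ n, ∃ D, M.Borel D ∧ (∀ i < n, M.ext (C i) ⊆ M.ext D) ∧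
      M.lt (M.meas (M.star (a := .pm) Q) D) (M.real r)) :
    ∃ D, M.Borel D ∧ (∀ i, M.ext (C i) ⊆ M.ext D) ∧
      M.lt (M.meas (M.star (a := .pm) Q) D) (M.real r) := by
  let f : Std Y (.fn (.set .pt) (.set (.set .pt))) := fun C D =>
    ⟨MeasurableSet (toSet D) ∧ toSet C ⊆ toSet D ∧ (Q (toSet D) : ℝ) < r⟩
  have key : ∀ C D, D ∈ M.ext (M.app (M.star f) C) ↔
      M.Borel D ∧ M.ext C ⊆ M.ext D ∧ M.lt (M.meas (M.star (a := .pm) Q) D) (M.real r) := by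
    intro C D
    rw [meas_lt_real_iff]
    let e : Env (Std Y) [.fn (.set .pt) (.set (.set .pt)), .set (.set .pt), .set (.set .pt),
        .prop] :=
      Env.cons (b := .fn (.set .pt) (.set (.set .pt))) f
        (Env.cons (b := .set (.set .pt)) (fun C => ⟨MeasurableSet (toSet C)⟩)
        (Env.cons (b := .set (.set .pt)) (fun C => ⟨(Q (toSet C) : ℝ) < r⟩)
        (Env.cons (b := .prop) ⟨True⟩ Env.nil)))
    have h₁ := (M.transfer (.all (.set .pt) (.all (.set .pt)
      (.imp (.eq (.app (.app v2 v1) v0) v5) (.eq (.app v3 v0) v5)))) e).1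
      (fun C D h => up_eq_true.2 (up_eq_true.1 h).1) C D
    have h₂ := (M.transfer (.all (.set .pt) (.all (.set .pt)
      (.imp (.eq (.app (.app v2 v1) v0) v5)
        (.all .pt (.imp (.eq (.app v2 v0) v6) (.eq (.app v1 v0) v6)))))) e).1
      (fun C D h x hx => up_eq_true.2 ((up_eq_true.1 h).2.1 (up_eq_true.1 hx))) C D
    have h₃ := (M.transfer (.all (.set .pt) (.all (.set .pt)
      (.imp (.eq (.app (.app v2 v1) v0) v5) (.eq (.app v4 v0) v5)))) e).1
      (fun C D h => up_eq_true.2 (up_eq_true.1 h).2.2) C D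
    have h₄ := (M.transfer (.all (.set .pt) (.all (.set .pt) (.imp (.eq (.app v3 v0) v5)
      (.imp (.all .pt (.imp (.eq (.app v2 v0) v6) (.eq (.app v1 v0) v6)))
        (.imp (.eq (.app v4 v0) v5) (.eq (.app (.app v2 v1) v0) v5)))))) e).1
      (fun C D h h' h'' => up_eq_true.2 ⟨up_eq_true.1 h,
        fun x hx => up_eq_true.1 (h' x (up_eq_true.2 hx)), up_eq_true.1 h''⟩) C D
    exact ⟨fun h => ⟨h₁ h, fun x hx => h₂ h x hx, h₃ h⟩,
      fun h => h₄ h.1 (fun x hx => h.2.1 hx) h.2.2⟩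
  obtain ⟨D, hD⟩ := hM (.set .pt) (Set.range fun n => M.app (M.star f) (C n))
    ((Cardinal.mk_le_aleph0_iff.2 (Set.countable_range _)).trans_lt (by
      rw [← Cardinal.aleph_zero]; exact Cardinal.aleph_lt_aleph.2 zero_lt_one))
    (fun 𝓖 h𝓖 => by
      classical
      choose! i hi using h𝓖
      obtain ⟨D, hD, hCD, hr⟩ := h (𝓖.sup i + 1)
      refine ⟨D, Set.mem_iInter₂.2 fun B hB => ?_⟩
      rw [← hi hB]
      exact (key _ _).2 ⟨hD, hCD _ (Nat.lt_succ_of_le (Finset.le_sup hB)), hr⟩)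
  have hD' : ∀ n, D ∈ M.ext (M.app (M.star f) (C n)) := fun n =>
    Set.mem_iInter₂.1 hD _ ⟨n, rfl⟩
  exact ⟨D, ((key _ _).1 (hD' 0)).1, fun i => ((key _ _).1 (hD' i)).2.1,
    ((key _ _).1 (hD' 0)).2.2⟩

/-- The union of the first `n` members of a sequence of internal sets. -/
def unionLT (C : ℕ → M.Dom (.set .pt)) : ℕ → M.Dom (.set .pt)
  | 0 => M.diff M.univ M.univ
  | n + 1 => M.union (unionLT C n) (C n)

theorem borel_unionLT {C : ℕ → M.Dom (.set .pt)} (hC : ∀ n, M.Borel (C n)) (n : ℕ) :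
    M.Borel (unionLT C n) := by
  induction n with
  | zero => exact Borel.univ.diff Borel.univ
  | succ n ih => exact ih.union (hC n)

theorem ext_subset_unionLT (C : ℕ → M.Dom (.set .pt)) {i n : ℕ} (h : i < n) :
    M.ext (C i) ⊆ M.ext (unionLT C n) := by
  induction n with
  | zero => exact absurd h i.not_lt_zero
  | succ n ih =>
    rw [unionLT, ext_union]
    rcases Nat.lt_succ_iff_lt_or_eq.1 h with h | rfl
    exacts [(ih h).trans Set.subset_union_left, Set.subset_union_right]

theorem stMeas_empty : stMeas Q (M.diff M.univ M.univ) = 0 := by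
  have h₁ := stMeas_diff_add_le (Q := Q) M.univ (Borel.univ (M := M))
  have h₂ : stMeas Q (M.univ (Y := Y)) ≤ stMeas Q (M.diff M.univ (M.diff M.univ M.univ)) :=
    stMeas_mono (by simp [ext_diff, ext_univ])
  linarith [stMeas_nonneg (Q := Q) (M.diff M.univ (M.univ (Y := Y)))]

theorem stMeas_unionLT_le (C : ℕ → M.Dom (.set .pt)) (n : ℕ) :
    stMeas Q (unionLT C n) ≤ ∑ i ∈ Finset.range n, stMeas Q (C i) := by
  induction n with
  | zero => simp [unionLT, stMeas_empty]
  | succ n ih =>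
    rw [Finset.sum_range_succ]
    exact (stMeas_union_le _ _).trans (by gcongr)

open scoped ENNReal

variable (M Q) in
/-- The infimum of the measures of the internal Borel sets that contain `S`. -/
noncomputable def outerValue (S : Set (M.Dom .pt)) : ℝ≥0∞ :=
  ⨅ (C : M.Dom (.set .pt)) (_ : M.Borel C ∧ S ⊆ M.ext C), ENNReal.ofReal (stMeas Q C)

theorem outerValue_le {S : Set (M.Dom .pt)} {C : M.Dom (.set .pt)} (hC : M.Borel C)
    (hS : S ⊆ M.ext C) : M.outerValue Q S ≤ ENNReal.ofReal (stMeas Q C) :=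
  iInf₂_le C ⟨hC, hS⟩

theorem exists_stMeas_lt {S : Set (M.Dom .pt)} {r : ℝ≥0∞} (h : M.outerValue Q S < r) :
    ∃ C, M.Borel C ∧ S ⊆ M.ext C ∧ ENNReal.ofReal (stMeas Q C) < r := by
  simp only [outerValue, iInf_lt_iff] at h
  obtain ⟨C, hC, h⟩ := h
  exact ⟨C, hC.1, hC.2, h⟩

theorem outerValue_le_one (S : Set (M.Dom .pt)) : M.outerValue Q S ≤ 1 := by
  refine (outerValue_le Borel.univ (by simp [ext_univ])).trans ?_
  simp [stMeas_univ]

/-- Saturation turns the finite subadditivity of `st ∘ *Q` into the countable subadditivity of the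
outer value. -/
theorem outerValue_iUnion_le (hM : M.Saturated (Cardinal.aleph 1)) (S : ℕ → Set (M.Dom .pt)) :
    M.outerValue Q (⋃ n, S n) ≤ ∑' n, M.outerValue Q (S n) := by
  refine ENNReal.le_of_forall_pos_le_add fun ε hε hfin => ?_
  obtain ⟨δ, hδ, hsum⟩ := ENNReal.exists_pos_sum_of_countable
    (ENNReal.coe_ne_zero.2 (half_pos hε).ne') ℕ
  have hlt : ∀ n, M.outerValue Q (S n) < M.outerValue Q (S n) + δ n := fun n =>
    ENNReal.lt_add_right ((outerValue_le_one _).trans_lt ENNReal.one_lt_top).ne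
      (ENNReal.coe_ne_zero.2 (hδ n).ne')
  choose C hC hSC hCr using fun n => exists_stMeas_lt (hlt n)
  set R : ℝ≥0∞ := ∑' n, M.outerValue Q (S n) + ε with hR
  have hRfin : R ≠ ∞ := ENNReal.add_ne_top.2 ⟨hfin.ne, ENNReal.coe_ne_top⟩
  have hsumlt : ∑' n, (M.outerValue Q (S n) + δ n) < R := by
    rw [ENNReal.tsum_add, hR]
    refine ENNReal.add_lt_add_left hfin.ne (hsum.trans_le ?_)
    exact ENNReal.coe_le_coe.2 (half_le_self hε.le)
  have hfinite : ∀ n, M.lt (M.meas (M.star (a := .pm) Q) (unionLT C n)) (M.real R.toReal) := by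
    intro n
    refine meas_lt_of_stMeas_lt ((stMeas_unionLT_le C n).trans_lt ?_)
    rw [← ENNReal.ofReal_lt_iff_lt_toReal (Finset.sum_nonneg fun _ _ => stMeas_nonneg _) hRfin,
      ENNReal.ofReal_sum_of_nonneg fun _ _ => stMeas_nonneg _]
    exact ((Finset.sum_le_sum fun i _ => (hCr i).le).trans (ENNReal.sum_le_tsum _)).trans_lt hsumlt
  obtain ⟨D, hD, hCD, hDR⟩ := exists_superset_of_saturated (Q := Q) hM C R.toReal fun n =>
    ⟨unionLT C n, borel_unionLT hC n, fun i hi => ext_subset_unionLT C hi, hfinite n⟩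
  refine (outerValue_le hD (Set.iUnion_subset fun n => (hSC n).trans (hCD n))).trans ?_
  exact (ENNReal.ofReal_le_iff_le_toReal hRfin).2 (stMeas_le_of_meas_lt hDR)

variable (Q) in
/-- The Loeb outer measure. -/
noncomputable def loebOuter (hM : M.Saturated (Cardinal.aleph 1)) : OuterMeasure (M.Dom .pt) where
  measureOf := M.outerValue Q
  empty := le_antisymm ((outerValue_le (Borel.univ.diff Borel.univ) (Set.empty_subset _)).trans
    (by simp [stMeas_empty])) zero_le
  mono h := le_iInf₂ fun C hC => outerValue_le hC.1 (h.trans hC.2)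
  iUnion_nat S _ := outerValue_iUnion_le hM S

theorem le_outerValue {S : Set (M.Dom .pt)} {C : M.Dom (.set .pt)} (h : M.ext C ⊆ S) :
    ENNReal.ofReal (stMeas Q C) ≤ M.outerValue Q S :=
  le_iInf₂ fun _ hD => ENNReal.ofReal_le_ofReal (stMeas_mono (h.trans hD.2))

theorem stMeas_le_add_diff (C D : M.Dom (.set .pt)) :
    stMeas Q C ≤ stMeas Q D + stMeas Q (M.diff C D) := by
  refine (stMeas_mono ?_).trans (stMeas_union_le _ _)
  rw [ext_union, ext_diff, Set.union_sdiff_self]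
  exact Set.subset_union_right

/-- Approximable sets split every set additively, and conversely the splitting of `*Y` alone
yields inner and outer approximations. -/
theorem isCaratheodory_loebOuter_iff (hM : M.Saturated (Cardinal.aleph 1))
    {S : Set (M.Dom .pt)} :
    MeasurableSet[(loebOuter Q hM).caratheodory] S ↔ M.LoebMeasurable (M.star (a := .pm) Q) S := by
  rw [OuterMeasure.isCaratheodory_iff_le]
  constructor
  · intro h ε hε
    have hS : M.outerValue Q S + M.outerValue Q Sᶜ ≤ 1 := by
      have := h Set.univ
      rw [Set.univ_inter, ← Set.compl_eq_univ_sdiff] at this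
      exact this.trans (outerValue_le_one _)
    have hlt : ∀ S : Set (M.Dom .pt),
        M.outerValue Q S < M.outerValue Q S + ENNReal.ofReal (ε / 2) := fun S =>
      ENNReal.lt_add_right ((outerValue_le_one _).trans_lt ENNReal.one_lt_top).ne
        (by simpa using hε)
    obtain ⟨C, hC, hSC, hCε⟩ := exists_stMeas_lt (hlt S)
    obtain ⟨D, hD, hSD, hDε⟩ := exists_stMeas_lt (hlt Sᶜ)
    have hCD : stMeas Q C + stMeas Q D < 1 + ε := by
      have := (ENNReal.add_lt_add hCε hDε).trans_le
        ((add_add_add_comm _ _ _ _).trans_le (add_le_add_left hS _))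
      rw [← ENNReal.ofReal_add (stMeas_nonneg _) (stMeas_nonneg _), ← ENNReal.ofReal_one,
        ← ENNReal.ofReal_add (half_pos hε).le (half_pos hε).le, add_halves,
        ← ENNReal.ofReal_add zero_le_one hε.le] at this
      exact (ENNReal.ofReal_lt_ofReal_iff (by linarith)).1 this
    have hDS : M.ext (M.diff M.univ D) ⊆ S := by
      rw [ext_diff, ext_univ, ← Set.compl_eq_univ_sdiff]
      exact Set.compl_subset_comm.1 hSD
    refine ⟨M.diff M.univ D, C, Borel.univ.diff hD, hC, hDS, hSC, meas_lt_of_stMeas_lt ?_⟩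
    -- Since `C ∪ D` is everything, `C ∩ D` has measure at most `C + D - 1`.
    have h₁ := stMeas_diff_add_le (Q := Q) C hD
    have h₂ := stMeas_le_add_diff (Q := Q) M.univ D
    rw [stMeas_univ] at h₂
    have h₃ : stMeas Q (M.diff M.univ D) ≤ stMeas Q (M.diff C D) := stMeas_mono (by
      rw [ext_diff C D]
      exact fun x hx => ⟨hSC (hDS hx), by rw [ext_diff] at hx; exact hx.2⟩)
    have h₄ : stMeas Q (M.diff C (M.diff M.univ D)) ≤ stMeas Q (M.diff C (M.diff C D)) :=
      stMeas_mono (by simp only [ext_diff, ext_univ]; intro x; simp)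
    linarith
  · intro h T
    refine le_iInf₂ fun C hC => ENNReal.le_of_forall_pos_le_add fun ε hε _ => ?_
    obtain ⟨Ai, Ao, hAi, hAo, hi, ho, hlt⟩ := h ε hε
    have h₁ := stMeas_le_of_meas_lt hlt
    have h₂ := stMeas_diff_add_le (Q := Q) C hAi
    have h₃ := stMeas_le_add_diff (Q := Q) (M.diff C (M.diff C Ao)) (M.diff C (M.diff C Ai))
    have h₄ : stMeas Q (M.diff (M.diff C (M.diff C Ao)) (M.diff C (M.diff C Ai))) ≤
        stMeas Q (M.diff Ao Ai) := stMeas_mono (by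
      simp only [ext_diff]; intro x; simp only [Set.mem_sdiff]; tauto)
    have h₅ : M.outerValue Q (T ∩ S) ≤ ENNReal.ofReal (stMeas Q (M.diff C (M.diff C Ao))) :=
      outerValue_le (hC.1.diff (hC.1.diff hAo)) (by
        rw [ext_diff, ext_diff, Set.sdiff_sdiff_right_self]
        exact Set.inter_subset_inter hC.2 ho)
    have h₆ : M.outerValue Q (T \ S) ≤ ENNReal.ofReal (stMeas Q (M.diff C Ai)) :=
      outerValue_le (hC.1.diff hAi) (by rw [ext_diff]; exact Set.sdiff_subset_sdiff hC.2 hi)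
    refine (add_le_add h₅ h₆).trans ?_
    rw [← ENNReal.ofReal_add (stMeas_nonneg _) (stMeas_nonneg _), ← ENNReal.ofReal_coe_nnreal,
      ← ENNReal.ofReal_add (stMeas_nonneg _) ε.coe_nonneg]
    exact ENNReal.ofReal_le_ofReal (by linarith)

theorem loebMeasurable_ext {C : M.Dom (.set .pt)} (hC : M.Borel C) :
    M.LoebMeasurable (M.star (a := .pm) Q) (M.ext C) := by
  refine fun ε hε => ⟨C, C, hC, hC, subset_rfl, subset_rfl, meas_lt_of_stMeas_lt ?_⟩
  have : stMeas Q (M.diff C C) ≤ 0 := stMeas_empty (M := M) (Q := Q) ▸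
    stMeas_mono (by simp [ext_diff])
  linarith

theorem exists_isLoebSpace (hM : M.Saturated (Cardinal.aleph 1)) (Q : ProbabilityMeasure Y) :
    ∃ (𝓐 : MeasurableSpace (M.Dom .pt)) (ν : @Measure (M.Dom .pt) 𝓐),
      M.IsLoebSpace (M.star (a := .pm) Q) 𝓐 ν := by
  refine ⟨(loebOuter Q hM).caratheodory,
    @OuterMeasure.toMeasure _ (loebOuter Q hM).caratheodory (loebOuter Q hM) le_rfl,
    fun S => isCaratheodory_loebOuter_iff hM, fun S hS => ?_, fun S hS => ?_⟩ <;>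
    rw [@toMeasure_apply _ (loebOuter Q hM).caratheodory _ _ _
      ((isCaratheodory_loebOuter_iff hM).2 hS)]
  · refine ⟨?_, fun b hb => ?_⟩
    · rintro _ ⟨C, -, hCS, rfl⟩
      exact le_outerValue hCS
    · refine ENNReal.le_of_forall_pos_le_add fun ε hε _ => ?_
      obtain ⟨Ai, Ao, hAi, hAo, hi, ho, hlt⟩ := hS ε hε
      refine ((outerValue_le hAo ho).trans ?_).trans
        (add_le_add_left (hb ⟨Ai, hAi, hi, rfl⟩) _)
      rw [← ENNReal.ofReal_coe_nnreal]
      refine le_of_le_of_eq ?_ (ENNReal.ofReal_add (stMeas_nonneg (Q := Q) Ai) ε.coe_nonneg)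
      exact ENNReal.ofReal_le_ofReal ((stMeas_le_add_diff Ao Ai).trans
        (add_le_add_right (stMeas_le_of_meas_lt hlt) _))
  · refine ⟨?_, fun b hb => le_iInf₂ fun C hC => hb ⟨C, hC.1, hC.2, rfl⟩⟩
    rintro _ ⟨C, hC, hSC, rfl⟩
    exact outerValue_le hC hSC

theorem IsLoebSpace.measurableSet_ext {𝓐 : MeasurableSpace (M.Dom .pt)} {ν : Measure (M.Dom .pt)}
    (h : M.IsLoebSpace (M.star (a := .pm) Q) 𝓐 ν) {C : M.Dom (.set .pt)} (hC : M.Borel C) :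
    MeasurableSet (M.ext C) :=
  (h.measurableSet_iff _).2 (loebMeasurable_ext hC)

theorem IsLoebSpace.measure_ext {𝓐 : MeasurableSpace (M.Dom .pt)} {ν : Measure (M.Dom .pt)}
    (h : M.IsLoebSpace (M.star (a := .pm) Q) 𝓐 ν) {C : M.Dom (.set .pt)} (hC : M.Borel C) :
    ν (M.ext C) = ENNReal.ofReal (stMeas Q C) :=
  le_antisymm ((h.outer _ (loebMeasurable_ext hC)).1 ⟨C, hC, subset_rfl, rfl⟩)
    ((h.inner _ (loebMeasurable_ext hC)).1 ⟨C, hC, subset_rfl, rfl⟩)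

theorem IsLoebSpace.isProbabilityMeasure {𝓐 : MeasurableSpace (M.Dom .pt)}
    {ν : Measure (M.Dom .pt)} (h : M.IsLoebSpace (M.star (a := .pm) Q) 𝓐 ν) :
    IsProbabilityMeasure ν :=
  ⟨by rw [← ext_univ, h.measure_ext Borel.univ, stMeas_univ, ENNReal.ofReal_one]⟩

end Model
end
end NSA

namespace NSA

/-! ### Riemann sums over level sets -/

/-- A layer-cake sum over the levels `h, 2h, …, nh` determines `min t (n h)` up to `h`; at a value
of `t` equal to a level either choice of the summand is allowed. -/
theorem level_sum_bounds {t h : ℝ} (ht : 0 ≤ t) (hh : 0 < h) (n : ℕ) (p : ℕ → Prop)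
    [DecidablePred p] (h₁ : ∀ k : ℕ, t < k * h → p k) (h₂ : ∀ k : ℕ, p k → t ≤ k * h) :
    (∑ k ∈ Finset.range n, if p (k + 1) then 0 else h) ≤ min t (n * h) ∧
      min t (n * h) ≤ h + ∑ k ∈ Finset.range n, if p (k + 1) then 0 else h := by
  induction n with
  | zero => simp [ht, hh.le]
  | succ n ih =>
    rw [Finset.sum_range_succ]
    rcases le_or_gt t (n * h) with hn | hn
    · have hp : p (n + 1) := h₁ _ (by push_cast; linarith)
      have hm : min t ((n + 1 : ℕ) * h) = min t (n * h) := by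
        rw [min_eq_left hn, min_eq_left (by push_cast; linarith)]
      rw [hm, if_pos hp, add_zero]
      exact ih
    · have hs : (∑ k ∈ Finset.range n, if p (k + 1) then 0 else h) = n * h := by
        rw [Finset.sum_congr rfl fun k hk => if_neg fun hp => ?_]
        · simp
        · refine (h₂ _ hp).not_gt (lt_of_le_of_lt ?_ hn)
          exact mul_le_mul_of_nonneg_right (Nat.cast_le.2 (Finset.mem_range.1 hk)) hh.le
      rw [hs]
      split_ifs with hp
      · have := h₂ _ hp
        rw [min_eq_left this]
        push_cast at this
        constructor <;> linarith
      · have : ((n + 1 : ℕ) : ℝ) * h ≤ t := not_lt.1 fun h' => hp (h₁ _ h')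
        rw [min_eq_right this]
        push_cast
        constructor <;> linarith

theorem abs_integral_min_sub_level_sum_le {Ω : Type*} [MeasurableSpace Ω] (ν : Measure Ω)
    [IsProbabilityMeasure ν] {g : Ω → ℝ} (hg : AEMeasurable g ν) (hg₀ : ∀ᵐ x ∂ν, 0 ≤ g x)
    {h : ℝ} (hh : 0 < h) (n : ℕ) {E : ℕ → Set Ω} (hE : ∀ k, MeasurableSet (E k))
    (hgE : ∀ᵐ x ∂ν, ∀ k : ℕ, (g x < k * h → x ∈ E k) ∧ (x ∈ E k → g x ≤ k * h)) :
    |∫ x, min (g x) (n * h) ∂ν - ∑ k ∈ Finset.range n, h * (1 - ν.real (E (k + 1)))| ≤ h := by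
  classical
  let s : Ω → ℝ := fun x => ∑ k ∈ Finset.range n, (E (k + 1))ᶜ.indicator (fun _ => h) x
  have hs : Integrable s ν := integrable_finsetSum _ fun k _ =>
    (integrable_const h).indicator (hE _).compl
  have hsum : ∫ x, s x ∂ν = ∑ k ∈ Finset.range n, h * (1 - ν.real (E (k + 1))) := by
    rw [integral_finsetSum _ fun k _ => (integrable_const h).indicator (hE _).compl]
    refine Finset.sum_congr rfl fun k _ => ?_
    rw [integral_indicator_const _ (hE _).compl, probReal_compl_eq_one_sub (hE _), smul_eq_mul,
      mul_comm]
  have hb : ∀ᵐ x ∂ν, s x ≤ min (g x) (n * h) ∧ min (g x) (n * h) ≤ h + s x := by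
    filter_upwards [hg₀, hgE] with x hx hxE
    have := level_sum_bounds hx hh n (fun k => x ∈ E k) (fun k => (hxE k).1) (fun k => (hxE k).2)
    simpa only [s, Set.indicator_apply, Set.mem_compl_iff, ite_not] using this
  have hmin : Integrable (fun x => min (g x) (n * h)) ν := by
    refine Integrable.of_bound (hg.min aemeasurable_const).aestronglyMeasurable (n * h) ?_
    filter_upwards [hg₀] with x hx
    have : 0 ≤ n * h := by positivity
    rw [Real.norm_eq_abs, abs_of_nonneg (le_min hx this)]
    exact min_le_right _ _
  rw [← hsum, abs_le]
  have h₁ := integral_mono_ae hs hmin (hb.mono fun x hx => hx.1)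
  have h₂ := integral_mono_ae hmin ((integrable_const h).add hs) (hb.mono fun x hx => hx.2)
  rw [integral_add' (integrable_const h) hs, integral_const, probReal_univ, one_smul] at h₂
  constructor <;> linarith

/-! ### Uniform integrability of the density of `P` relative to `Q` on a partition -/

section
variable {Y : Type u} [MeasurableSpace Y]

/-- A nonnegative density with integral at most one, with tails bounded in terms of `κ`: above the
height `κ ε` only mass `ε` is left. -/
structure IsTameDensity (Q : ProbabilityMeasure Y) (κ : ℝ → ℝ) (f : Y → ℝ) : Prop where
  measurable : Measurable f
  nonneg : ∀ y, 0 ≤ f y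
  integrable : Integrable f (Q : Measure Y)
  integral_le_one : ∫ y, f y ∂(Q : Measure Y) ≤ 1
  tail : ∀ ε K : ℝ, 0 < ε → κ ε ≤ K →
    ∫ y, f y ∂(Q : Measure Y) ≤ ∫ y, min (f y) K ∂(Q : Measure Y) + ε

theorem integral_sum_div_indicator_le (P Q : ProbabilityMeasure Y) {A : ℕ → Set Y}
    (s : Finset ℕ) (hA : ∀ i ∈ s, MeasurableSet (A i))
    (hd : (s : Set ℕ).PairwiseDisjoint A) :
    Integrable (fun y => ∑ i ∈ s, (P (A i) : ℝ) / (Q (A i) : ℝ) *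
      (A i).indicator (fun _ => (1 : ℝ)) y) (Q : Measure Y) ∧
    ∫ y, ∑ i ∈ s, (P (A i) : ℝ) / (Q (A i) : ℝ) *
      (A i).indicator (fun _ => (1 : ℝ)) y ∂(Q : Measure Y) ≤ P (⋃ i ∈ s, A i) := by
  have hi : ∀ i ∈ s, Integrable (fun y => (P (A i) : ℝ) / (Q (A i) : ℝ) *
      (A i).indicator (fun _ => (1 : ℝ)) y) (Q : Measure Y) := fun i hi =>
    ((integrable_const 1).indicator (hA i hi)).const_mul _
  refine ⟨integrable_finsetSum _ hi, ?_⟩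
  rw [integral_finsetSum _ hi]
  have : ((P (⋃ i ∈ s, A i) : NNReal) : ℝ) = ∑ i ∈ s, (P (A i) : ℝ) :=
    measureReal_biUnion_finset (μ := (P : Measure Y)) hd hA
  rw [this]
  refine Finset.sum_le_sum fun i hi => ?_
  rw [integral_const_mul, integral_indicator_const _ (hA i hi), smul_eq_mul, mul_one]
  change (P (A i) : ℝ) / (Q (A i) : ℝ) * (Q (A i) : ℝ) ≤ P (A i)
  rcases eq_or_ne (Q (A i) : ℝ) 0 with h | h
  · rw [h, mul_zero]; exact NNReal.zero_le_coe
  · rw [div_mul_cancel₀ _ h]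

/-- The tail of the density above the height `K` lives on the union of the cells with quotient
above `K`; its `Q`-measure is at most `1 / K`, so domination bounds its `P`-measure. -/
theorem exists_isTameDensity_of_dominates {P Q : ProbabilityMeasure Y} (hPQ : Dominates Q P) :
    ∃ κ : ℝ → ℝ, ∀ (A : ℕ → Set Y) (s : Finset ℕ), (∀ i ∈ s, MeasurableSet (A i)) →
      (s : Set ℕ).PairwiseDisjoint A →
      IsTameDensity Q κ fun y => ∑ i ∈ s, (P (A i) : ℝ) / (Q (A i) : ℝ) *
        (A i).indicator (fun _ => (1 : ℝ)) y := by
  classical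
  choose! δ hδ hδP using hPQ
  refine ⟨fun ε => 2 / δ ε, fun A s hA hd => ?_⟩
  set c : ℕ → ℝ := fun i => (P (A i) : ℝ) / (Q (A i) : ℝ) with hc
  have hc₀ : ∀ i, 0 ≤ c i := fun i => by positivity
  have hterm : ∀ i y, 0 ≤ c i * (A i).indicator (fun _ => (1 : ℝ)) y := fun i y =>
    mul_nonneg (hc₀ i) (Set.indicator_nonneg (fun _ _ => zero_le_one) _)
  have hf₀ : ∀ y, 0 ≤ ∑ i ∈ s, c i * (A i).indicator (fun _ => (1 : ℝ)) y := fun y =>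
    Finset.sum_nonneg fun i _ => hterm i y
  obtain ⟨hint, hle⟩ := integral_sum_div_indicator_le P Q s hA hd
  have hm : Measurable fun y => ∑ i ∈ s, c i * (A i).indicator (fun _ => (1 : ℝ)) y :=
    Finset.measurable_fun_sum _ fun i hi => (measurable_const.indicator (hA i hi)).const_mul _
  refine ⟨hm, hf₀, hint, hle.trans (by exact_mod_cast P.apply_le_one _), fun ε K hε hK => ?_⟩
  have hK₀ : 0 < K := lt_of_lt_of_le (div_pos two_pos (hδ ε hε)) hK
  -- The cells on which the density exceeds `K`.
  let I := s.filter fun i => K < c i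
  have hIs : ∀ i ∈ I, i ∈ s := fun i hi => (Finset.mem_filter.1 hi).1
  have hIA : ∀ i ∈ I, MeasurableSet (A i) := fun i hi => hA i (hIs i hi)
  have hId : (I : Set ℕ).PairwiseDisjoint A := hd.subset fun i hi => hIs i hi
  obtain ⟨hintI, hleI⟩ := integral_sum_div_indicator_le P Q I hIA hId
  have hP : ((P (⋃ i ∈ I, A i) : NNReal) : ℝ) = ∑ i ∈ I, (P (A i) : ℝ) :=
    measureReal_biUnion_finset (μ := (P : Measure Y)) hId hIA
  have hQ : ((Q (⋃ i ∈ I, A i) : NNReal) : ℝ) = ∑ i ∈ I, (Q (A i) : ℝ) :=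
    measureReal_biUnion_finset (μ := (Q : Measure Y)) hId hIA
  have hKQ : K * (Q (⋃ i ∈ I, A i) : ℝ) ≤ 1 := by
    have h₁ : ((P (⋃ i ∈ I, A i) : NNReal) : ℝ) ≤ 1 := by exact_mod_cast P.apply_le_one _
    refine le_trans ?_ h₁
    rw [hP, hQ, Finset.mul_sum]
    refine Finset.sum_le_sum fun i hi => ?_
    have hKc := (Finset.mem_filter.1 hi).2
    have hQi : (0 : ℝ) < Q (A i) := by
      refine lt_of_le_of_ne NNReal.zero_le_coe fun h => ?_
      simp only [hc, ← h, div_zero] at hKc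
      exact hKc.not_ge hK₀.le
    exact ((lt_div_iff₀ hQi).1 hKc).le
  have hlt : ((P (⋃ i ∈ I, A i) : NNReal) : ℝ) < ε := by
    refine hδP ε hε _ (Finset.measurableSet_biUnion _ hIA) ?_
    have h₂ : 2 ≤ K * δ ε := (div_le_iff₀ (hδ ε hε)).1 hK
    by_contra! h
    nlinarith [mul_le_mul_of_nonneg_left h hK₀.le]
  have hpt : ∀ y, ∑ i ∈ s, c i * (A i).indicator (fun _ => (1 : ℝ)) y ≤
      min (∑ i ∈ s, c i * (A i).indicator (fun _ => (1 : ℝ)) y) K +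
        ∑ i ∈ I, c i * (A i).indicator (fun _ => (1 : ℝ)) y := by
    intro y
    have hI₀ : 0 ≤ ∑ i ∈ I, c i * (A i).indicator (fun _ => (1 : ℝ)) y :=
      Finset.sum_nonneg fun i _ => hterm i y
    by_cases hy : ∃ i ∈ s, y ∈ A i
    · obtain ⟨i, hi, hy⟩ := hy
      have hone : ∀ j ∈ s, j ≠ i → c j * (A j).indicator (fun _ => (1 : ℝ)) y = 0 := by
        intro j hj hji
        rw [Set.indicator_of_notMem, mul_zero]
        exact fun hyj => Set.disjoint_left.1 (hd hj hi hji) hyj hy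
      rw [Finset.sum_eq_single_of_mem i hi hone, Set.indicator_of_mem hy, mul_one]
      rcases le_or_gt (c i) K with h | h
      · rw [min_eq_left h]; linarith
      · rw [Finset.sum_eq_single_of_mem i (Finset.mem_filter.2 ⟨hi, h⟩)
          fun j hj => hone j (hIs j hj), Set.indicator_of_mem hy, mul_one, min_eq_right h.le]
        linarith
    · have h0 : ∑ i ∈ s, c i * (A i).indicator (fun _ => (1 : ℝ)) y = 0 :=
        Finset.sum_eq_zero fun i hi => by
          rw [Set.indicator_of_notMem (fun h => hy ⟨i, hi, h⟩), mul_zero]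
      rw [h0, min_eq_left hK₀.le]
      linarith
  have hmin : Integrable (fun y => min (∑ i ∈ s, c i * (A i).indicator (fun _ => (1 : ℝ)) y) K)
      (Q : Measure Y) := hint.inf (integrable_const K)
  have := integral_mono hint (hmin.add hintI) hpt
  rw [integral_add' hmin hintI] at this
  linarith

end
end NSA

/-! ### Monotone convergence for truncations -/

/-- Monotone convergence for the truncations of a nonnegative function. -/
theorem integrable_and_integral_eq_of_tendsto_truncation {Ω : Type*} [MeasurableSpace Ω]
    {ν : Measure Ω} [IsFiniteMeasure ν] {g : Ω → ℝ} (hg : Measurable g)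
    (hg₀ : ∀ x, 0 ≤ g x) {s : ℝ}
    (h : Tendsto (fun K : ℕ => ∫ x, min (g x) K ∂ν) atTop (𝓝 s)) :
    Integrable g ν ∧ ∫ x, g x ∂ν = s := by
  have hm₀ : ∀ (K : ℕ) x, 0 ≤ min (g x) K := fun K x => le_min (hg₀ x) K.cast_nonneg
  have hm : ∀ K : ℕ, Integrable (fun x => min (g x) K) ν := fun K =>
    Integrable.of_bound (hg.min measurable_const).aestronglyMeasurable K
      (ae_of_all _ fun x => by
        rw [Real.norm_eq_abs, abs_of_nonneg (hm₀ K x)]; exact min_le_right _ _)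
  have hs : 0 ≤ s := ge_of_tendsto' h fun K => integral_nonneg (hm₀ K)
  have h₁ : Tendsto (fun K : ℕ => ∫⁻ x, ENNReal.ofReal (min (g x) K) ∂ν) atTop
      (𝓝 (∫⁻ x, ENNReal.ofReal (g x) ∂ν)) := by
    refine lintegral_tendsto_of_tendsto_of_monotone
      (fun K => (hg.min measurable_const).ennreal_ofReal.aemeasurable)
      (ae_of_all _ fun x => ?_) (ae_of_all _ fun x => ?_)
    · exact fun i j hij => ENNReal.ofReal_le_ofReal (min_le_min_left _ (Nat.cast_le.2 hij))
    · refine tendsto_const_nhds.congr' ?_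
      filter_upwards [eventually_ge_atTop ⌈g x⌉₊] with K hK
      rw [min_eq_left (Nat.ceil_le.1 hK)]
  have h₂ : ∫⁻ x, ENNReal.ofReal (g x) ∂ν = ENNReal.ofReal s := by
    refine tendsto_nhds_unique h₁ ((ENNReal.tendsto_ofReal h).congr fun K => ?_)
    rw [ofReal_integral_eq_lintegral_ofReal (hm K) (ae_of_all _ (hm₀ K))]
  have hi : Integrable g ν := ⟨hg.aestronglyMeasurable, by
    rw [hasFiniteIntegral_iff_ofReal (ae_of_all _ hg₀), h₂]; exact ENNReal.ofReal_lt_top⟩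
  refine ⟨hi, ?_⟩
  rw [integral_eq_lintegral_of_nonneg_ae (ae_of_all _ hg₀) hg.aestronglyMeasurable, h₂,
    ENNReal.toReal_ofReal hs]

namespace NSA
section
variable {Y : Type u} [MeasurableSpace Y]
namespace Model
variable {M : Model.{u, v} Y}

/-! ### Internal densities with bounded tails -/

theorem of_star_const {a : Ty} {p : Prop} {x : M.Dom a} (h : M.Star (fun _ => p) x) : p := by
  by_contra hp
  exact star_not.1 (star_of_forall (fun _ => hp) x) h

theorem star_forall_apply {a b : Ty} {p : Std Y b → Prop} {F : M.Dom (.fn a b)}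
    (h : M.Star (fun f : Std Y (.fn a b) => ∀ y, p (f y)) F) (x : M.Dom a) :
    M.Star p (M.app F x) :=
  (M.transfer (.all (.fn a b) (.imp (.eq (.app v1 v0) v3) (.all a (.eq (.app v3 (.app v1 v0)) v4))))
    (Env.cons (b := .set (.fn a b)) (fun f => ⟨∀ y, p (f y)⟩)
      (Env.cons (b := .set b) (fun y => ⟨p y⟩) (Env.cons (b := .prop) ⟨True⟩ Env.nil)))).1
    (fun _ hf x => up_eq_true.2 (up_eq_true.1 hf x)) F h x

/-- The internal set `{x | F x < q}`. -/
def sublevel (F : M.Dom (.fn .pt .real)) (q : ℝ) : M.Dom (.set .pt) :=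
  M.app (M.star (a := .fn (.fn .pt .real) (.set .pt)) fun f => ofSet {y | toFun f y < q}) F

theorem mem_ext_sublevel {F : M.Dom (.fn .pt .real)} {q : ℝ} {x : M.Dom .pt} :
    x ∈ M.ext (sublevel F q) ↔ M.lt (M.app F x) (M.real q) := by
  rw [lt_real_iff]
  have := (M.transfer (.all (.fn .pt .real) (.all .pt
      (.eq (.app (.app v2 v1) v0) (.app v3 (.app v1 v0)))))
    (Env.cons (b := .fn (.fn .pt .real) (.set .pt)) (fun f => ofSet {y | toFun f y < q})
      (Env.cons (b := .set .real) (fun r => ⟨r.down < q⟩) Env.nil))).1 (fun _ _ => rfl) F x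
  exact iff_of_eq (congrArg M.Holds this)

variable {Q : ProbabilityMeasure Y} {κ : ℝ → ℝ} {F : M.Dom (.fn .pt .real)}
  {𝓐 : MeasurableSpace (M.Dom .pt)} {ν : Measure (M.Dom .pt)}

theorem borel_sublevel
    (hF : M.Star (fun f : Std Y (.fn .pt .real) => IsTameDensity Q κ (toFun f)) F) (q : ℝ) :
    M.Borel (sublevel F q) :=
  (M.star_comp (fun C : Std Y (.set .pt) => MeasurableSet (toSet C)) _ F).2
    (star_mono (fun _ hf => hf.measurable measurableSet_Iio) hF)

theorem not_apply_lt_zero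
    (hF : M.Star (fun f : Std Y (.fn .pt .real) => IsTameDensity Q κ (toFun f)) F)
    (x : M.Dom .pt) : ¬ M.lt (M.app F x) (M.real 0) := by
  rw [lt_real_iff, ← star_not]
  exact star_forall_apply (p := fun r : Std Y .real => ¬ r.down < 0)
    (star_mono (fun _ hf y => not_lt.2 (hf.nonneg y)) hF) x

theorem nearStd_apply_iff
    (hF : M.Star (fun f : Std Y (.fn .pt .real) => IsTameDensity Q κ (toFun f)) F)
    (x : M.Dom .pt) : M.NearStd (M.app F x) ↔ ∃ n : ℕ, x ∈ M.ext (sublevel F n) := by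
  simp only [mem_ext_sublevel]
  refine ⟨fun h => ?_, fun ⟨n, hn⟩ => nearStd_of_bounded (not_apply_lt_zero hF x) hn⟩
  obtain ⟨n, hn⟩ := exists_nat_gt (M.st (M.app F x))
  exact ⟨n, h.lt_of_st_lt hn⟩

theorem st_apply_nonneg
    (hF : M.Star (fun f : Std Y (.fn .pt .real) => IsTameDensity Q κ (toFun f)) F)
    (x : M.Dom .pt) : 0 ≤ M.st (M.app F x) := by
  by_cases h : M.NearStd (M.app F x)
  · exact h.le_st (not_apply_lt_zero hF x)
  · rw [st, dif_neg h]

theorem measurable_st_apply (hν : M.IsLoebSpace (M.star (a := .pm) Q) 𝓐 ν)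
    (hF : M.Star (fun f : Std Y (.fn .pt .real) => IsTameDensity Q κ (toFun f)) F) :
    Measurable fun x => M.st (M.app F x) := by
  have hN : MeasurableSet {x | M.NearStd (M.app F x)} := by
    simp only [nearStd_apply_iff hF, Set.ofPred_exists]
    exact MeasurableSet.iUnion fun n => hν.measurableSet_ext (borel_sublevel hF n)
  refine measurable_of_Iio fun r => ?_
  have : (fun x => M.st (M.app F x)) ⁻¹' Set.Iio r =
      ({x | M.NearStd (M.app F x)} ∩ ⋃ (q : ℚ) (_ : (q : ℝ) < r), M.ext (sublevel F q)) ∪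
      ({x | M.NearStd (M.app F x)}ᶜ ∩ {_x | 0 < r}) := by
    ext x
    by_cases h : M.NearStd (M.app F x)
    · simp only [Set.mem_preimage, Set.mem_Iio, Set.mem_union, Set.mem_inter_iff, Set.mem_ofPred_eq,
        h, true_and, Set.mem_iUnion, mem_ext_sublevel, Set.mem_compl_iff, not_true, false_and,
        or_false, exists_prop]
      constructor
      · intro hx
        obtain ⟨q, hq, hqr⟩ := exists_rat_btwn hx
        exact ⟨q, hqr, h.lt_of_st_lt hq⟩
      · rintro ⟨q, hqr, hq⟩
        exact (h.st_le hq).trans_lt hqr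
    · simp [h, st]
  rw [this]
  exact MeasurableSet.union (hN.inter (MeasurableSet.iUnion fun q => MeasurableSet.iUnion fun _ =>
    hν.measurableSet_ext (borel_sublevel hF q))) (hN.compl.inter (.const _))

theorem IsLoebSpace.measureReal_ext (hν : M.IsLoebSpace (M.star (a := .pm) Q) 𝓐 ν)
    {C : M.Dom (.set .pt)} (hC : M.Borel C) : ν.real (M.ext C) = stMeas Q C := by
  rw [Measure.real, hν.measure_ext hC, ENNReal.toReal_ofReal (stMeas_nonneg C)]

/-- By Markov's inequality `F ≥ n` has measure at most `1 / n`, so `F` is finite almost surely. -/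
theorem ae_nearStd_apply (hν : M.IsLoebSpace (M.star (a := .pm) Q) 𝓐 ν)
    (hF : M.Star (fun f : Std Y (.fn .pt .real) => IsTameDensity Q κ (toFun f)) F) :
    ∀ᵐ x ∂ν, M.NearStd (M.app F x) := by
  have := hν.isProbabilityMeasure
  have hn : ∀ n : ℕ, ν.real (M.ext (sublevel F (n + 1 : ℕ)))ᶜ ≤ 1 / (n + 1) := by
    intro n
    have hB := borel_sublevel hF (n + 1 : ℕ)
    rw [probReal_compl_eq_one_sub (hν.measurableSet_ext hB), hν.measureReal_ext hB]
    have hn₀ : (0 : ℝ) < n + 1 := by positivity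
    have : 1 - 1 / ((n : ℝ) + 1) ≤ stMeas Q (sublevel F (n + 1 : ℕ)) := by
      refine (nearStd_meas _).le_st ?_
      rw [meas_lt_real_iff, ← star_not, sublevel, M.star_comp]
      refine star_mono (fun f hf => not_lt.2 ?_) hF
      have h₁ := mul_meas_ge_le_integral_of_nonneg (ae_of_all _ hf.nonneg) hf.integrable
        ((n : ℝ) + 1)
      have h₂ := h₁.trans hf.integral_le_one
      have h₃ : (Q : Measure Y).real {y | toFun f y < (n + 1 : ℕ)}ᶜ ≤ 1 / (n + 1) := by
        rw [le_div_iff₀ hn₀, mul_comm]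
        convert h₂ using 4
        ext y; simp
      have hm : MeasurableSet {y | toFun f y < (n + 1 : ℕ)} := hf.measurable measurableSet_Iio
      rw [probReal_compl_eq_one_sub hm] at h₃
      change _ ≤ (Q : Measure Y).real {y | toFun f y < (n + 1 : ℕ)}
      linarith
    linarith
  rw [ae_iff]
  refine (measureReal_eq_zero_iff).1 (le_antisymm ?_ measureReal_nonneg)
  refine ge_of_tendsto' tendsto_one_div_add_atTop_nhds_zero_nat fun n => ?_
  refine (measureReal_mono fun x hx => ?_).trans (hn n)
  exact fun h => hx ((nearStd_apply_iff hF x).2 ⟨_, h⟩)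

theorem lt_absSub_integral_iff {s ε : ℝ} :
    M.lt (M.absSub (M.integral (M.star (a := .pm) Q) F) (M.real s)) (M.real ε) ↔
      M.Star (fun f : Std Y (.fn .pt .real) => |∫ y, toFun f y ∂(Q : Measure Y) - s| < ε) F := by
  rw [lt_absSub_iff, integral, M.star_app, M.star_comp]

/-- At a large truncation height both `F` and `st F` are within small error of one and the same
standard layer-cake sum. -/
theorem exists_forall_lt_absSub_integral (hν : M.IsLoebSpace (M.star (a := .pm) Q) 𝓐 ν)
    (hF : M.Star (fun f : Std Y (.fn .pt .real) => IsTameDensity Q κ (toFun f)) F)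
    {ε : ℝ} (hε : 0 < ε) : ∃ K₀ : ℕ, ∀ K ≥ K₀,
      M.Star (fun f : Std Y (.fn .pt .real) =>
        |∫ y, toFun f y ∂(Q : Measure Y) - ∫ x, min (M.st (M.app F x)) K ∂ν| < ε) F := by
  have := hν.isProbabilityMeasure
  refine ⟨max 1 ⌈κ (ε / 4)⌉₊, fun K hK => ?_⟩
  have hK₁ : (1 : ℝ) ≤ K := by exact_mod_cast (le_max_left _ _).trans hK
  have hKκ : κ (ε / 4) ≤ K := Nat.ceil_le.1 ((le_max_right _ _).trans hK)
  -- With step `h = 1 / N < ε / 8` the two layer-cake sums together lose less than `ε / 4`; the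
  -- tail of `F` and the standard parts of the measures of the level sets lose `ε / 4` each.
  obtain ⟨N, hN⟩ := exists_nat_gt (8 / ε)
  have hN₀ : (0 : ℝ) < N := (by positivity : (0 : ℝ) < 8 / ε).trans hN
  set h : ℝ := 1 / N with hh
  have hh₀ : 0 < h := by positivity
  have hhε : h < ε / 8 := by
    rw [hh, div_lt_iff₀ hN₀]
    rw [div_lt_iff₀ hε] at hN
    linarith
  have hnh : ((K * N : ℕ) : ℝ) * h = K := by
    rw [hh]; push_cast; field_simp
  set t : ℕ → ℝ := fun k => stMeas Q (sublevel F (k * h)) with ht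
  -- The same sum for `st F` and the Loeb measure.
  have hst := abs_integral_min_sub_level_sum_le ν (measurable_st_apply hν hF).aemeasurable
    (ae_of_all _ (st_apply_nonneg hF)) hh₀ (K * N) (E := fun k => M.ext (sublevel F (k * h)))
    (fun k => hν.measurableSet_ext (borel_sublevel hF _)) (by
      filter_upwards [ae_nearStd_apply hν hF] with x hx k
      rw [mem_ext_sublevel]
      exact ⟨hx.lt_of_st_lt, hx.st_le⟩)
  simp only [hν.measureReal_ext (borel_sublevel hF _)] at hst
  rw [hnh] at hst
  have hη : 0 < ε / (4 * K) := by positivity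
  have hclose : M.Star (fun f : Std Y (.fn .pt .real) => ∀ k < K * N,
      |(Q : Measure Y).real {y | toFun f y < (k + 1 : ℕ) * h} - t (k + 1)| < ε / (4 * K)) F := by
    refine star_forall_lt _ fun k _ => ?_
    have : M.Star (fun r : Std Y .real => |r.down - t (k + 1)| < ε / (4 * K))
        (M.meas (M.star (a := .pm) Q) (sublevel F ((k + 1 : ℕ) * h))) :=
      lt_absSub_iff.1 ((nearStd_meas _).close_st _ hη)
    rw [meas, M.star_app, M.star_comp, sublevel, M.star_comp] at this
    exact this
  -- From here on the claim concerns a standard function `f`.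
  refine star_mono (fun f hf => ?_) (star_and.2 ⟨hF, hclose⟩)
  obtain ⟨hf, hk⟩ := hf
  have hsum := abs_integral_min_sub_level_sum_le (Q : Measure Y) hf.measurable.aemeasurable
    (ae_of_all _ hf.nonneg) hh₀ (K * N) (E := fun k => {y | toFun f y < k * h})
    (fun k => hf.measurable measurableSet_Iio)
    (ae_of_all _ fun y k => ⟨id, fun hy => le_of_lt hy⟩)
  rw [hnh] at hsum
  have hdiff : |∑ k ∈ Finset.range (K * N),
        h * (1 - (Q : Measure Y).real {y | toFun f y < (k + 1 : ℕ) * h}) -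
      ∑ k ∈ Finset.range (K * N), h * (1 - t (k + 1))| ≤ ε / 4 := by
    rw [← Finset.sum_sub_distrib]
    refine (Finset.abs_sum_le_sum_abs _ _).trans ?_
    have hb : ∀ k ∈ Finset.range (K * N),
        |h * (1 - (Q : Measure Y).real {y | toFun f y < (k + 1 : ℕ) * h}) -
          h * (1 - t (k + 1))| ≤ h * (ε / (4 * K)) := by
      intro k hk'
      rw [← mul_sub, abs_mul, abs_of_pos hh₀, sub_sub_sub_cancel_left, abs_sub_comm]
      exact mul_le_mul_of_nonneg_left (hk k (Finset.mem_range.1 hk')).le hh₀.le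
    refine (Finset.sum_le_card_nsmul _ _ _ hb).trans_eq ?_
    rw [Finset.card_range, nsmul_eq_mul, ← mul_assoc, hnh]
    field_simp
  have htail := hf.tail (ε / 4) K (by positivity) hKκ
  have hmin : ∫ y, min (toFun f y) K ∂(Q : Measure Y) ≤ ∫ y, toFun f y ∂(Q : Measure Y) :=
    integral_mono (hf.integrable.inf (integrable_const _)) hf.integrable fun y => min_le_left _ _
  rw [abs_le] at hst hsum hdiff
  rw [abs_lt]
  constructor <;> linarith

theorem sIntegrable_of_isTameDensity (hM : M.Saturated (Cardinal.aleph 1))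
    (hF : M.Star (fun f : Std Y (.fn .pt .real) => IsTameDensity Q κ (toFun f)) F) :
    M.SIntegrable (M.star (a := .pm) Q) F := by
  obtain ⟨𝓐, ν, hν⟩ := exists_isLoebSpace hM Q
  have := hν.isProbabilityMeasure
  obtain ⟨s, hs⟩ : M.NearStd (M.integral (M.star (a := .pm) Q) F) := by
    have hI : ∀ q : ℝ, M.lt (M.integral (M.star (a := .pm) Q) F) (M.real q) ↔
        M.Star (fun f : Std Y (.fn .pt .real) => ∫ y, toFun f y ∂(Q : Measure Y) < q) F := fun q => by
      rw [lt_real_iff, integral, M.star_app, M.star_comp]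
    refine nearStd_of_bounded (p := 0) (q := 2) ?_ ?_
    · rw [hI, ← star_not]
      exact star_mono (fun f hf => not_lt.2 (integral_nonneg hf.nonneg)) hF
    · rw [hI]
      exact star_mono (fun f hf => hf.integral_le_one.trans_lt one_lt_two) hF
  have hlim : Tendsto (fun K : ℕ => ∫ x, min (M.st (M.app F x)) K ∂ν) atTop (𝓝 s) := by
    refine Metric.tendsto_atTop.2 fun ε hε => ?_
    obtain ⟨K₀, hK₀⟩ := exists_forall_lt_absSub_integral hν hF (half_pos hε)
    refine ⟨K₀, fun K hK => of_star_const (x := F) ?_⟩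
    refine star_mono (fun f hf => ?_) (star_and.2
      ⟨hK₀ K hK, lt_absSub_integral_iff.1 (hs (ε / 2) (half_pos hε))⟩)
    rw [Real.dist_eq]
    rw [abs_lt] at hf ⊢
    rw [abs_lt] at hf
    constructor <;> linarith [hf.1.1, hf.1.2, hf.2.1, hf.2.2]
  obtain ⟨hint, hval⟩ := integrable_and_integral_eq_of_tendsto_truncation
    (measurable_st_apply hν hF) (st_apply_nonneg hF) hlim
  refine ⟨?_, 𝓐, ν, hν, ae_nearStd_apply hν hF, hint, hval ▸ hs⟩
  rw [InternallyIntegrable, M.star_app]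
  exact star_mono (p := fun f : Std Y (.fn .pt .real) => IsTameDensity Q κ (toFun f))
    (q := fun f : Std Y (.fn .pt .real) => Integrable (toFun f) (Q : Measure Y))
    (fun f hf => hf.integrable) hF

/-- Transfer of a property that holds for the densities of all finite disjoint measurable
sequences. -/
theorem star_hyperApproximant {P : ProbabilityMeasure Y} {p : (Y → ℝ) → Prop}
    (hp : ∀ (A : ℕ → Set Y) (s : Finset ℕ), (∀ i ∈ s, MeasurableSet (A i)) →
      (s : Set ℕ).PairwiseDisjoint A →
      p fun y => ∑ i ∈ s, (P (A i) : ℝ) / (Q (A i) : ℝ) * (A i).indicator (fun _ => (1 : ℝ)) y)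
    {A : M.Dom (.fn .nat (.set .pt))} {T : M.Dom .nat}
    (hA : ∀ i, M.natLe (M.star (a := .nat) ⟨1⟩) i → M.natLe i T → M.Borel (M.app A i))
    (hd : ∀ i j, M.natLe (M.star (a := .nat) ⟨1⟩) i → M.natLe i T →
      M.natLe (M.star (a := .nat) ⟨1⟩) j → M.natLe j T → i ≠ j →
      Disjoint (M.ext (M.app A i)) (M.ext (M.app A j))) :
    M.Star (fun f : Std Y (.fn .pt .real) => p (toFun f)) (M.hyperApproximant P Q A T) := by
  simp only [natLe, M.star_app] at hA hd
  rw [hyperApproximant, M.star_app, M.star_app]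
  refine (M.transfer (.all (.fn .nat (.set .pt)) (.all .nat
      (.imp (.all .nat (.imp (.eq (.app v4 v0) v3) (.imp (.eq (.app (.app v5 v0) v1) v3)
        (.eq (.app v6 (.app v2 v0)) v3))))
      (.imp (.all .nat (.all .nat (.imp (.eq (.app v5 v1) v4)
        (.imp (.eq (.app (.app v6 v1) v2) v4) (.imp (.eq (.app v5 v0) v4)
        (.imp (.eq (.app (.app v6 v0) v2) v4) (.imp (.imp (.eq v1 v0) .bot)
        (.all .pt (.imp (.eq (.app (.app v4 v2) v0) v5)
          (.imp (.eq (.app (.app v4 v1) v0) v5) .bot))))))))))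
        (.eq (.app v7 (.app (.app v6 v1) v0)) v2)))))
    (Env.cons (b := .prop) ⟨True⟩ (Env.cons (b := .set .nat) (fun i => ⟨1 ≤ i.down⟩)
      (Env.cons (b := .fn .nat (.set .nat)) (fun i j => ⟨i.down ≤ j.down⟩)
      (Env.cons (b := .set (.set .pt)) (fun C => ⟨MeasurableSet (toSet C)⟩)
      (Env.cons (b := .fn (.fn .nat (.set .pt)) (.fn .nat (.fn .pt .real))) (approximant P Q)
      (Env.cons (b := .set (.fn .pt .real)) (fun f => ⟨p (toFun f)⟩) Env.nil))))))).1
    ?_ A T hA fun i j h₁ h₂ h₃ h₄ h₅ x hx hx' => Set.disjoint_left.1 (hd i j h₁ h₂ h₃ h₄ h₅) hx hx'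
  intro A n hA hd
  refine up_eq_true.2 (hp (fun i => toSet (A ⟨i⟩)) (Finset.Icc 1 n.down) (fun i hi => ?_)
    fun i hi j hj hij => ?_)
  · obtain ⟨h₁, h₂⟩ := Finset.mem_Icc.1 hi
    exact up_eq_true.1 (hA ⟨i⟩ (up_eq_true.2 h₁) (up_eq_true.2 h₂))
  · obtain ⟨h₁, h₂⟩ := Finset.mem_Icc.1 hi
    obtain ⟨h₃, h₄⟩ := Finset.mem_Icc.1 hj
    exact Set.disjoint_left.2 fun x hx hx' => hd ⟨i⟩ ⟨j⟩ (up_eq_true.2 h₁) (up_eq_true.2 h₂)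
      (up_eq_true.2 h₃) (up_eq_true.2 h₄) (fun h => hij (congrArg ULift.down h)) x
      (up_eq_true.2 hx) (up_eq_true.2 hx')

end Model
end
end NSA

theorem mainTheorem5 {Y : Type u} [MetricSpace Y] [CompactSpace Y] [MeasurableSpace Y]
    [BorelSpace Y] (M : NSA.Model.{u, v} Y) (hM : M.Saturated (Cardinal.aleph 1))
    (A : M.Dom (.fn .nat (.set .pt))) (T : M.Dom .nat) (hA : M.IsFinePartition A T)
    (P Q : ProbabilityMeasure Y) (hPQ : NSA.Dominates Q P) :
    M.SIntegrable (M.star (a := .pm) Q) (M.hyperApproximant P Q A T) := by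
  obtain ⟨κ, hκ⟩ := NSA.exists_isTameDensity_of_dominates hPQ
  exact NSA.Model.sIntegrable_of_isTameDensity hM
    (NSA.Model.star_hyperApproximant hκ hA.borel hA.disjoint)
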